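/- Let $\mu_W$ be the Wiener measure on $(C(\mathbb R_+),\mathcal B(C(\mathbb R_+)))$ and $\mu_L$ the Lebesgue measure on $([0,1],\mathcal B([0,1]))$. Consider $\Omega=C(\mathbb R_+)\times[0,1]^{\mathbb N_0}$ with $\mathcal F=\mathcal B(C(\mathbb R_+))\otimes\mathcal B([0,1])^{\otimes\mathbb N_0}$ and $\mathsf P=\mu_W\times\mu_L^{\mathbb N_0}$. For $\omega=(x,r_0,r_1,\ldots)\in\Omega$ put $B_t(\omega)=x(t)$, $t\ge 0$, and $R_n(\omega)=r_n$, $n\in\mathbb N_0$, and let $\mathcal F_t=\bigcap_{\varepsilon>0}\sigma(R_n,B_s;\,n\in\mathbb N_0,\,s\in[0,t+\varepsilon])$. Let $Y_t=e^{B_t-t/2}$ for $t\in[0,\infty)$ and $Y_\infty=0$. Then the $R_n$, $n\in\mathbb N_0$, are independent, $\mathcal F_0$-measurable and uniformly distributed on $[0,1]$, and $B$ is an $(\mathcal F_t,\mathsf P)$-Brownian motion (a standard Brownian motion adapted to $(\mathcal F_t)$ whose increments $B_t-B_s$, $s\le t$, are independent of $\mathcal F_s$), independent of $(R_n)$. Moreover,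 let $X=(X_n)_{n\in\mathbb N_0}$ be a nonnegative supermartingale, on some filtered probability space, with $\mathsf E X_0\le 1$. Then there exists a nondecreasing family $(\tau_n)_{n\in\mathbb N_0}$ of $[0,\infty]$-valued $(\mathcal F_t)$-stopping times on $\Omega$ such that the processes $(X_n)_{n\in\mathbb N_0}$ and $(Y_{\tau_n})_{n\in\mathbb N_0}$ have the same law. -/

import Mathlib

open MeasureTheory ProbabilityTheory
open scoped NNReal

namespace GBMEmbedding

/-- The path space `C(ℝ₊)` (with the topology of locally uniform convergence) carries its
Borel σ-algebra. -/
instance : MeasurableSpace C(ℝ≥0, ℝ) := borel _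

instance : BorelSpace C(ℝ≥0, ℝ) := ⟨rfl⟩

/-- `μ` is the Wiener measure: the law on `C(ℝ₊)` under which the coordinate process has the
finite-dimensional distributions of a standard Brownian motion started at `0`. This determines
`μ` uniquely. -/
def IsWienerMeasure (μ : Measure C(ℝ≥0, ℝ)) : Prop :=
  IsPreBrownianReal (fun (t : ℝ≥0) (x : C(ℝ≥0, ℝ)) => x t) μ

/-- The Wiener measure `μ_W` on `C(ℝ₊)`: the unique measure satisfying `IsWienerMeasure`. -/
noncomputable def wienerMeasure : Measure C(ℝ≥0, ℝ) :=
  Classical.epsilon IsWienerMeasure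

/-- `Ω = C(ℝ₊) × [0,1]^ℕ`, with the product σ-algebra. -/
abbrev SampleSpace : Type := C(ℝ≥0, ℝ) × (ℕ → unitInterval)

/-- `P = μ_W × μ_L^ℕ`, where `μ_L` is Lebesgue measure on `[0,1]`. -/
noncomputable def sampleMeasure : Measure SampleSpace :=
  wienerMeasure.prod (Measure.infinitePi fun _ : ℕ => (volume : Measure unitInterval))

/-- `B_t(x, r) = x(t)`. -/
def coordB (t : ℝ≥0) (ω : SampleSpace) : ℝ := ω.1 t

/-- `R_n(x, r) = r_n`. -/
def coordR (n : ℕ) (ω : SampleSpace) : unitInterval := ω.2 n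

lemma measurable_coordB (t : ℝ≥0) : Measurable (coordB t) :=
  (continuous_eval_const (F := C(ℝ≥0, ℝ)) t).measurable.comp measurable_fst

lemma measurable_coordR (n : ℕ) : Measurable (coordR n) :=
  (measurable_pi_apply n).comp measurable_snd

/-- `σ(R_n, B_s; n ∈ ℕ, s ∈ [0,u])`. -/
abbrev rawSigma (u : ℝ≥0) : MeasurableSpace SampleSpace :=
  (⨆ n : ℕ, MeasurableSpace.comap (coordR n) inferInstance) ⊔
    ⨆ s : Set.Iic u, MeasurableSpace.comap (coordB s) inferInstance

lemma rawSigma_mono {u v : ℝ≥0} (h : u ≤ v) : rawSigma u ≤ rawSigma v := by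
  refine sup_le_sup le_rfl (iSup_le fun s => ?_)
  exact le_iSup_of_le (⟨s.1, s.2.trans h⟩ : Set.Iic v) le_rfl

lemma rawSigma_le (u : ℝ≥0) : rawSigma u ≤ (inferInstance : MeasurableSpace SampleSpace) :=
  sup_le (iSup_le fun n => (measurable_coordR n).comap_le)
    (iSup_le fun s => (measurable_coordB s).comap_le)

/-- The right-continuous filtration `F_t = ⋂_{ε > 0} σ(R_n, B_s; n ∈ ℕ, s ∈ [0,t+ε])`. -/
def sampleFiltration : Filtration ℝ≥0 (inferInstance : MeasurableSpace SampleSpace) where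
  seq t := ⨅ ε : {ε : ℝ≥0 // 0 < ε}, rawSigma (t + ε)
  mono' _ _ h := iInf_mono fun ε => rawSigma_mono (by gcongr)
  le' t := (iInf_le (fun ε : {ε : ℝ≥0 // 0 < ε} => rawSigma (t + ε)) ⟨1, one_pos⟩).trans
    (rawSigma_le _)

/-- `W` is an `(𝓕_t, P)`-Brownian motion: a standard Brownian motion which is adapted to `𝓕` and
whose increments `W_t - W_s`, `s ≤ t`, are independent of `𝓕_s`. -/
structure IsBrownianMotionFor {Ω : Type*} {m : MeasurableSpace Ω} (W : ℝ≥0 → Ω → ℝ)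
    (𝓕 : Filtration ℝ≥0 m) (P : Measure Ω) : Prop where
  isBrownian : IsBrownianReal W P
  adapted : Adapted 𝓕 W
  indep : ∀ s t : ℝ≥0, s ≤ t →
    Indep (MeasurableSpace.comap (fun ω => W t ω - W s ω) inferInstance) (𝓕 s) P

/-- The geometric Brownian motion `Y_t = exp (B_t - t / 2)` for `t ∈ [0,∞)`, extended to `t = ∞`
by its (almost sure) limit `Y_∞ = 0`. Here `[0,∞]` is `WithTop ℝ≥0`. -/
noncomputable def gbm : WithTop ℝ≥0 → SampleSpace → ℝ
  | (t : ℝ≥0), ω => Real.exp (coordB t ω - t / 2)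
  | ⊤, _ => 0

end GBMEmbedding

/-!
The theorem is a discrete-time Skorokhod embedding of a nonnegative supermartingale into a geometric
Brownian motion `Y`, with the help of independent randomization.

The martingale `Y` is positive, continuous, starts at `1` and tends to `0` along the integers
(`ae_tendsto_expBM`, from the decay of the means of `√Y`). Start it at a stopping time `τ` at the
value `x` and stop it on leaving `(a, b)` with `a ≤ x < b`, or on reaching `a` if there is no upper
barrier. By optional stopping the exit value has, given the past of `τ`, the law on `{a, b}` with
mean `x`, respectively the point mass at `a`. If `Y` never exits, then its limit `Y_∞ = 0` is the
lower barrier, so that these formulas need no exception (`gbm_exitTime_mem`,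
`lintegral_gbm_exitTime`).

Every law `κ` on `[0, ∞)` with mean at most `x` is a mixture of such exit laws: a pair `a ≤ x < b`
is drawn with density proportional to `b - a` with respect to `κ ⊗ κ`, which accounts for all the mass
above `x` and for a part of the mass below, and the remaining mass below `x` is produced by single
lower barriers (`exists_barriers`). The construction is measurable in `x` and `κ`, so that one
uniform variable is enough to draw the barriers.

Applied to the conditional laws of `X_{n+1}` given `X_0, …, X_n`, whose means are at most `X_n`,
this gives the next stopping time (`exists_stoppingTime_of_kernel`). The uniform variable used must be
independent of the past. This is why the stopping time `τ_n` is built for the filtration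
`stageFiltration (n + 1)`, which involves `B` and `R_0, …, R_n` only and for which `Y` is still a
martingale, and why the step from `τ_n` to `τ_{n+1}` draws the barriers from `R_{n+1}`.

The definition of `wienerMeasure` by choice is empty of content unless a Wiener measure exists. One
is obtained as the law of the Lévy–Ciesielski series (`exists_isWienerMeasure`). That `B` is a Brownian
motion for the right-continuous filtration follows by continuity from the independence of
`B_t - B_u` of `σ(R, B_s; s ≤ u)` for `u` decreasing to `s`.
-/

namespace GBMEmbedding

section

open Filter Topology
open scoped ENNReal

/-! ### Limits of Gaussian processes -/

lemma charFunDual_of_isGaussian_pi {ι : Type*} [Fintype ι] [DecidableEq ι] (ν : Measure (ι → ℝ))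
    [IsGaussian ν] (K : ι → ι → ℝ) (h0 : ∀ i, ∫ x, x i ∂ν = 0)
    (hK : ∀ i j, cov[fun x ↦ x i, fun x ↦ x j; ν] = K i j) (L : StrongDual ℝ (ι → ℝ)) :
    charFunDual ν L =
      Complex.exp (-((∑ i, ∑ j, L (Pi.single i 1) * L (Pi.single j 1) * K i j : ℝ) : ℂ) / 2) := by
  have hm (i : ι) : MemLp (fun x : ι → ℝ ↦ x i) 2 ν :=
    (IsGaussian.hasGaussianLaw_id.eval i).memLp_two
  have hL : (L : (ι → ℝ) → ℝ) = fun x ↦ ∑ i, L (Pi.single i 1) * x i := by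
    ext x
    conv_lhs => rw [pi_eq_sum_univ' x]
    simp only [map_sum, map_smul, smul_eq_mul]
    refine Finset.sum_congr rfl fun i _ ↦ ?_
    rw [mul_comm]
  rw [IsGaussian.charFunDual_eq]
  have h1 : ν[L] = 0 := by
    rw [hL, integral_finsetSum _ fun i _ ↦ ((hm i).integrable one_le_two).const_mul _]
    simp [integral_const_mul, h0]
  have h2 : Var[L; ν] = ∑ i, ∑ j, L (Pi.single i 1) * L (Pi.single j 1) * K i j := by
    have hmeas : AEMeasurable (L : (ι → ℝ) → ℝ) ν := L.continuous.measurable.aemeasurable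
    rw [← covariance_self hmeas]
    conv_lhs => rw [hL]
    rw [covariance_fun_sum_fun_sum (fun i ↦ (hm i).const_mul _) (fun i ↦ (hm i).const_mul _)]
    refine Finset.sum_congr rfl fun i _ ↦ Finset.sum_congr rfl fun j _ ↦ ?_
    rw [covariance_const_mul_left, covariance_const_mul_right, hK]
    ring
  rw [h2, integral_complex_ofReal, h1]
  congr 1
  simp
  ring

/-- A pointwise almost sure limit of centred Gaussian processes whose covariances converge to
that of Brownian motion is a pre-Brownian motion. -/
theorem isPreBrownianReal_of_tendsto {Ω : Type*} {mΩ : MeasurableSpace Ω} {P : Measure Ω}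
    [IsProbabilityMeasure P] {W : ℕ → ℝ≥0 → Ω → ℝ} {X : ℝ≥0 → Ω → ℝ}
    (hG : ∀ n, IsGaussianProcess (W n) P) (h0 : ∀ n t, ∫ ω, W n t ω ∂P = 0)
    (hcov : ∀ s t, Tendsto (fun n ↦ cov[W n s, W n t; P]) atTop (𝓝 ((min s t : ℝ≥0) : ℝ)))
    (hlim : ∀ t, ∀ᵐ ω ∂P, Tendsto (fun n ↦ W n t ω) atTop (𝓝 (X t ω))) :
    IsPreBrownianReal X P where
  hasLaw I := by
    have hXm (t : ℝ≥0) : AEMeasurable (X t) P :=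
      aemeasurable_of_tendsto_metrizable_ae _ (fun n ↦ (hG n).aemeasurable t) (hlim t)
    have hXI : AEMeasurable (fun ω ↦ I.restrict (X · ω)) P :=
      aemeasurable_pi_lambda _ fun i ↦ hXm i
    have hWI (n : ℕ) : AEMeasurable (fun ω ↦ I.restrict (W n · ω)) P :=
      aemeasurable_pi_lambda _ fun i ↦ (hG n).aemeasurable i
    refine ⟨hXI, ?_⟩
    have := Measure.isProbabilityMeasure_map hXI
    refine Measure.ext_of_charFunDual ?_
    ext L
    have hlimI : ∀ᵐ ω ∂P, Tendsto (fun n ↦ I.restrict (W n · ω)) atTop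
        (𝓝 (I.restrict (X · ω))) := by
      have : ∀ᵐ ω ∂P, ∀ i : I, Tendsto (fun n ↦ W n i ω) atTop (𝓝 (X i ω)) :=
        ae_all_iff.2 fun i ↦ hlim i
      filter_upwards [this] with ω hω
      exact tendsto_pi_nhds.2 hω
    have hchar (Z : Ω → I → ℝ) (hZ : AEMeasurable Z P) :
        charFunDual (P.map Z) L = ∫ ω, Complex.exp (L (Z ω) * Complex.I) ∂P := by
      rw [charFunDual_apply, integral_map hZ]
      exact Measurable.aestronglyMeasurable (by fun_prop)
    have hconv : Tendsto (fun n ↦ charFunDual (P.map fun ω ↦ I.restrict (W n · ω)) L) atTop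
        (𝓝 (charFunDual (P.map fun ω ↦ I.restrict (X · ω)) L)) := by
      simp_rw [hchar _ (hWI _), hchar _ hXI]
      refine tendsto_integral_of_dominated_convergence (fun _ ↦ 1) (fun n ↦ ?_)
        (integrable_const _) (fun n ↦ ?_) ?_
      · exact (Measurable.comp_aemeasurable (g := fun x : I → ℝ ↦ Complex.exp (L x * Complex.I))
          (by fun_prop) (hWI n)).aestronglyMeasurable
      · exact Eventually.of_forall fun ω ↦ by simp [Complex.norm_exp]
      · filter_upwards [hlimI] with ω hω
        have hc : Continuous fun x : I → ℝ ↦ Complex.exp (L x * Complex.I) := by fun_prop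
        exact (hc.tendsto _).comp hω
    refine tendsto_nhds_unique hconv ?_
    have hW (n : ℕ) : charFunDual (P.map fun ω ↦ I.restrict (W n · ω)) L =
        Complex.exp (-((∑ i : I, ∑ j : I, L (Pi.single i 1) * L (Pi.single j 1) *
          cov[W n i, W n j; P] : ℝ) : ℂ) / 2) := by
      have := ((hG n).hasGaussianLaw I).isGaussian_map
      refine charFunDual_of_isGaussian_pi _ _ (fun i ↦ ?_) (fun i j ↦ ?_) L
      · rw [integral_map (hWI n) (measurable_pi_apply i).aestronglyMeasurable]
        exact h0 n i
      · rw [covariance_map (measurable_pi_apply i).aestronglyMeasurable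
          (measurable_pi_apply j).aestronglyMeasurable (hWI n)]
        rfl
    rw [charFunDual_of_isGaussian_pi (BrownianReal.projectiveFamily I)
      (fun i j ↦ ((min i.1 j.1 : ℝ≥0) : ℝ))
      (fun i ↦ BrownianReal.integral_eval_projectiveFamily I i)
      (fun i j ↦ by simpa using BrownianReal.covariance_eval_projectiveFamily I i j) L]
    simp_rw [hW]
    refine (Complex.continuous_exp.tendsto _).comp (Tendsto.div_const (Tendsto.neg ?_) _)
    refine (Complex.continuous_ofReal.tendsto _).comp ?_
    exact tendsto_finsetSum _ fun i _ ↦ tendsto_finsetSum _ fun j _ ↦ (hcov i j).const_mul _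

/-! ### Schauder functions -/

/-- The ramp `u ↦ max 0 (min u 1)`, a primitive of the indicator function of `[0,1]`. -/
noncomputable def ramp (u : ℝ) : ℝ := max 0 (min u 1)

/-- The tent function on `[0,1]`, a primitive of twice the Haar mother wavelet. -/
noncomputable def tent (u : ℝ) : ℝ := ramp (2 * u) - ramp (2 * u - 1)

/-- The Schauder functions: primitives of the Haar basis of `L²(ℝ₊)`. Level `0` is given by the
indicators of the unit intervals `[k,k+1]`, level `m+1` by the wavelets of width `2^{-m}`. -/
noncomputable def schauder : ℕ → ℕ → ℝ≥0 → ℝ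
  | 0, k, t => ramp (t - k)
  | m + 1, k, t => (√2 ^ m)⁻¹ / 2 * tent (2 ^ m * t - k)

lemma continuous_ramp : Continuous ramp := by unfold ramp; fun_prop

lemma continuous_tent : Continuous tent := by
  unfold tent; have := continuous_ramp; fun_prop

lemma continuous_schauder (m k : ℕ) : Continuous (schauder m k) := by
  have := continuous_ramp
  have := continuous_tent
  cases m <;> unfold schauder <;> fun_prop

lemma ramp_nonneg (u : ℝ) : 0 ≤ ramp u := le_max_left _ _
lemma ramp_le_one (u : ℝ) : ramp u ≤ 1 := by simp [ramp]
lemma ramp_of_nonpos {u : ℝ} (h : u ≤ 0) : ramp u = 0 := by simp [ramp, h]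
lemma ramp_of_one_le {u : ℝ} (h : 1 ≤ u) : ramp u = 1 := by simp [ramp, h]
lemma ramp_of_mem {u : ℝ} (h : 0 ≤ u) (h' : u ≤ 1) : ramp u = u := by simp [ramp, h, h']

lemma ramp_refine (u : ℝ) : ramp u = (ramp (2 * u) + ramp (2 * u - 1)) / 2 := by
  rcases le_total u 0 with h | h
  · rw [ramp_of_nonpos h, ramp_of_nonpos (by linarith), ramp_of_nonpos (by linarith)]; simp
  rcases le_total u (1 / 2) with h2 | h2
  · rw [ramp_of_mem h (by linarith), ramp_of_mem (by linarith) (by linarith),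
      ramp_of_nonpos (by linarith)]; ring
  rcases le_total u 1 with h3 | h3
  · rw [ramp_of_mem h (by linarith), ramp_of_one_le (by linarith),
      ramp_of_mem (by linarith) (by linarith)]; ring
  · rw [ramp_of_one_le h3, ramp_of_one_le (by linarith), ramp_of_one_le (by linarith)]; ring

lemma tent_of_nonpos {u : ℝ} (h : u ≤ 0) : tent u = 0 := by
  rw [tent, ramp_of_nonpos (by linarith), ramp_of_nonpos (by linarith), sub_zero]

lemma tent_of_one_le {u : ℝ} (h : 1 ≤ u) : tent u = 0 := by
  rw [tent, ramp_of_one_le (by linarith), ramp_of_one_le (by linarith), sub_self]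

lemma abs_tent_le_one (u : ℝ) : |tent u| ≤ 1 := by
  rw [tent, abs_le]
  constructor <;> linarith [ramp_nonneg (2 * u), ramp_nonneg (2 * u - 1), ramp_le_one (2 * u),
    ramp_le_one (2 * u - 1)]

/-- Polarised refinement identity: one level of Schauder functions turns the covariance of the
piecewise linear interpolation on a grid into the one on the grid of half the mesh. -/
lemma ramp_mul_add_tent_mul (u v : ℝ) :
    ramp u * ramp v + tent u * tent v / 4 =
      (ramp (2 * u) * ramp (2 * v) + ramp (2 * u - 1) * ramp (2 * v - 1)) / 2 := by
  rw [ramp_refine u, ramp_refine v, tent, tent]; ring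

lemma schauder_eq_zero {m k : ℕ} {t : ℝ≥0} (h : 2 ^ m * (t : ℝ) ≤ k) : schauder m k t = 0 := by
  cases m with
  | zero => exact ramp_of_nonpos (by simpa using h)
  | succ m =>
    have : 2 ^ m * (t : ℝ) ≤ 2 ^ (m + 1) * t := by
      rw [pow_succ]; nlinarith [t.2, pow_pos (two_pos (α := ℝ)) m, mul_nonneg
        (pow_pos (two_pos (α := ℝ)) m).le t.2]
    rw [schauder, tent_of_nonpos (by linarith), mul_zero]

lemma sum_range_two_mul {M : Type*} [AddCommMonoid M] (f : ℕ → M) (N : ℕ) :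
    ∑ k ∈ Finset.range (2 * N), f k = ∑ k ∈ Finset.range N, (f (2 * k) + f (2 * k + 1)) := by
  induction N with
  | zero => simp
  | succ N ih => rw [mul_add, mul_one, Finset.sum_range_succ, Finset.sum_range_succ, ih,
      Finset.sum_range_succ, add_assoc]

lemma sum_ramp_eq_of_le {u v : ℝ} {N M : ℕ} (hu : u ≤ N) (hNM : N ≤ M) :
    ∑ k ∈ Finset.range M, ramp (u - k) * ramp (v - k) =
      ∑ k ∈ Finset.range N, ramp (u - k) * ramp (v - k) := by
  symm
  refine Finset.sum_subset (Finset.range_mono hNM) fun k _ hk ↦ ?_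
  have : (N : ℝ) ≤ k := by exact_mod_cast not_lt.1 (by simpa using hk)
  rw [ramp_of_nonpos (by linarith), zero_mul]

lemma sum_schauder_mul (s t : ℝ≥0) (n N : ℕ) (hs : 2 ^ n * (s : ℝ) ≤ N) :
    ∑ m ∈ Finset.range (n + 1), ∑ k ∈ Finset.range N, schauder m k s * schauder m k t =
      (2 ^ n)⁻¹ * ∑ k ∈ Finset.range N, ramp (2 ^ n * s - k) * ramp (2 ^ n * t - k) := by
  induction n with
  | zero => simp [schauder]
  | succ n ih =>
    have hs' : 2 ^ n * (s : ℝ) ≤ N := by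
      refine le_trans ?_ hs
      gcongr <;> simp
    rw [Finset.sum_range_succ, ih hs', ← sum_ramp_eq_of_le hs (show N ≤ 2 * N by lia),
      sum_range_two_mul]
    simp only [schauder]
    rw [Finset.mul_sum, Finset.mul_sum, ← Finset.sum_add_distrib]
    refine Finset.sum_congr rfl fun k _ ↦ ?_
    have h2 : (√2 ^ n)⁻¹ * (√2 ^ n)⁻¹ = ((2 : ℝ) ^ n)⁻¹ := by
      rw [← mul_inv, ← mul_pow, Real.mul_self_sqrt (by norm_num)]
    have key := ramp_mul_add_tent_mul (2 ^ n * s - k) (2 ^ n * t - k)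
    have e1 : (2 : ℝ) ^ (n + 1) * s - (2 * k : ℕ) = 2 * (2 ^ n * s - k) := by push_cast; ring
    have e2 : (2 : ℝ) ^ (n + 1) * t - (2 * k : ℕ) = 2 * (2 ^ n * t - k) := by push_cast; ring
    have e3 : (2 : ℝ) ^ (n + 1) * s - (2 * k + 1 : ℕ) = 2 * (2 ^ n * s - k) - 1 := by
      push_cast; ring
    have e4 : (2 : ℝ) ^ (n + 1) * t - (2 * k + 1 : ℕ) = 2 * (2 ^ n * t - k) - 1 := by
      push_cast; ring
    rw [e1, e2, e3, e4]
    calc _ = ((2 : ℝ) ^ n)⁻¹ * (ramp (2 ^ n * s - k) * ramp (2 ^ n * t - k)) +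
          ((√2 ^ n)⁻¹ * (√2 ^ n)⁻¹) * (tent (2 ^ n * s - k) * tent (2 ^ n * t - k) / 4) := by ring
      _ = ((2 : ℝ) ^ n)⁻¹ * (ramp (2 ^ n * s - k) * ramp (2 ^ n * t - k) +
          tent (2 ^ n * s - k) * tent (2 ^ n * t - k) / 4) := by rw [h2]; ring
      _ = _ := by rw [key, pow_succ, mul_inv]; ring

lemma sum_ramp_eq {u : ℝ} (hu : 0 ≤ u) (N : ℕ) :
    ∑ k ∈ Finset.range N, ramp (u - k) = min u N := by
  induction N with
  | zero => simp [hu]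
  | succ N ih =>
    rw [Finset.sum_range_succ, ih]
    push_cast
    rcases le_total u N with h | h
    · rw [ramp_of_nonpos (by linarith), min_eq_left h, min_eq_left (by linarith), add_zero]
    rcases le_total u (N + 1) with h' | h'
    · rw [ramp_of_mem (by linarith) (by linarith), min_eq_right h, min_eq_left h']; ring
    · rw [ramp_of_one_le (by linarith), min_eq_right h, min_eq_right h']

lemma abs_sum_ramp_mul_sub_le {u v : ℝ} (hu : 0 ≤ u) (huv : u ≤ v) {N : ℕ} (hN : u ≤ N) :
    |∑ k ∈ Finset.range N, ramp (u - k) * ramp (v - k) - u| ≤ 1 := by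
  have h1 := sum_ramp_eq hu N
  rw [min_eq_left hN] at h1
  have h2 : ∑ k ∈ Finset.range N, ramp (u - k) * ramp (v - k) - u =
      - ∑ k ∈ Finset.range N, ramp (u - k) * (1 - ramp (v - k)) := by
    nth_rw 2 [← h1]
    rw [← Finset.sum_sub_distrib, ← Finset.sum_neg_distrib]
    exact Finset.sum_congr rfl fun k _ ↦ by ring
  have h0 (k : ℕ) : 0 ≤ ramp (u - k) * (1 - ramp (v - k)) :=
    mul_nonneg (ramp_nonneg _) (by linarith [ramp_le_one (v - k)])
  rw [h2, abs_neg, abs_of_nonneg (Finset.sum_nonneg fun k _ ↦ h0 k)]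
  -- only the term `k = ⌊u⌋` can be nonzero
  have hz (k : ℕ) (hk : k ≠ ⌊u⌋₊) : ramp (u - k) * (1 - ramp (v - k)) = 0 := by
    rcases lt_or_gt_of_ne hk with h | h
    · have : (k : ℝ) + 1 ≤ u := by
        have : ((k + 1 : ℕ) : ℝ) ≤ u := (Nat.le_floor_iff hu).1 h
        exact_mod_cast this
      rw [ramp_of_one_le (u := v - k) (by linarith)]; simp
    · rw [ramp_of_nonpos (by linarith [(Nat.floor_lt hu).1 h]), zero_mul]
  calc _ ≤ ∑ k ∈ Finset.range N, if k = ⌊u⌋₊ then (1 : ℝ) else 0 := by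
        refine Finset.sum_le_sum fun k _ ↦ ?_
        split_ifs with h
        · nlinarith [ramp_nonneg (u - k), ramp_le_one (u - k), ramp_nonneg (v - k)]
        · exact (hz k h).le
    _ ≤ 1 := by
        rw [Finset.sum_ite_eq']; split_ifs <;> norm_num

lemma tendsto_sum_schauder_mul {s t : ℝ≥0} (hst : s ≤ t) {N : ℕ → ℕ}
    (hN : ∀ n, 2 ^ n * (s : ℝ) ≤ N n) :
    Tendsto (fun n ↦ ∑ m ∈ Finset.range (n + 1), ∑ k ∈ Finset.range (N n),
      schauder m k s * schauder m k t) atTop (𝓝 (s : ℝ)) := by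
  have hz : Tendsto (fun n : ℕ ↦ ((2 : ℝ) ^ n)⁻¹) atTop (𝓝 0) := by
    simpa using tendsto_pow_atTop_nhds_zero_of_lt_one (r := (2 : ℝ)⁻¹) (by norm_num) (by norm_num)
  rw [tendsto_iff_norm_sub_tendsto_zero]
  refine squeeze_zero (fun _ ↦ norm_nonneg _) (fun n ↦ ?_) hz
  rw [sum_schauder_mul s t n (N n) (hN n)]
  have h := abs_sum_ramp_mul_sub_le (u := 2 ^ n * s) (v := 2 ^ n * t) (by positivity)
    (by gcongr) (hN n)
  have hp : (0 : ℝ) < 2 ^ n := by positivity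
  rw [Real.norm_eq_abs]
  have e : ((2 : ℝ) ^ n)⁻¹ * ∑ k ∈ Finset.range (N n), ramp (2 ^ n * s - k) * ramp (2 ^ n * t - k)
      - s = ((2 : ℝ) ^ n)⁻¹ * (∑ k ∈ Finset.range (N n), ramp (2 ^ n * s - k) *
        ramp (2 ^ n * t - k) - 2 ^ n * s) := by
    field_simp
  rw [e, abs_mul, abs_of_pos (inv_pos.2 hp)]
  exact mul_le_of_le_one_right (inv_pos.2 hp).le h

/-! ### Existence of the Wiener measure -/

/-- The level-`m` term of the Lévy–Ciesielski series with coefficients `ξ`. The sum is over a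
finite range depending on `t` only because the remaining Schauder functions vanish at `t`. -/
noncomputable def levelFun (m : ℕ) (ξ : ℕ × ℕ → ℝ) (t : ℝ≥0) : ℝ :=
  ∑ k ∈ Finset.range ⌈2 ^ m * (t : ℝ)⌉₊, ξ (m, k) * schauder m k t

lemma levelFun_eq (m : ℕ) (ξ : ℕ × ℕ → ℝ) {t : ℝ≥0} {N : ℕ} (hN : 2 ^ m * (t : ℝ) ≤ N) :
    levelFun m ξ t = ∑ k ∈ Finset.range N, ξ (m, k) * schauder m k t := by
  refine Finset.sum_subset (Finset.range_mono (Nat.ceil_le.2 hN)) fun k _ hk ↦ ?_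
  have : 2 ^ m * (t : ℝ) ≤ k := Nat.ceil_le.1 (not_lt.1 (by simpa using hk))
  rw [schauder_eq_zero this, mul_zero]

lemma continuous_levelFun (m : ℕ) :
    Continuous fun p : (ℕ × ℕ → ℝ) × ℝ≥0 ↦ levelFun m p.1 p.2 := by
  rw [continuous_iff_continuousAt]
  rintro ⟨ξ, t⟩
  obtain ⟨N, hN⟩ := exists_nat_gt (2 ^ m * (t : ℝ))
  have hopen : ∀ᶠ p : (ℕ × ℕ → ℝ) × ℝ≥0 in 𝓝 (ξ, t), 2 ^ m * (p.2 : ℝ) < N := by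
    have hc : Continuous fun p : (ℕ × ℕ → ℝ) × ℝ≥0 ↦ 2 ^ m * (p.2 : ℝ) := by fun_prop
    exact hc.continuousAt.eventually_lt continuousAt_const hN
  have hs : Continuous fun p : (ℕ × ℕ → ℝ) × ℝ≥0 ↦
      ∑ k ∈ Finset.range N, p.1 (m, k) * schauder m k p.2 := by
    have := continuous_schauder m
    fun_prop
  refine hs.continuousAt.congr ?_
  filter_upwards [hopen] with p hp
  rw [levelFun_eq m p.1 hp.le]

/-- `levelFun` as a continuous map from coefficients to paths. -/
noncomputable def levelMap (m : ℕ) : C(ℕ × ℕ → ℝ, C(ℝ≥0, ℝ)) :=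
  ContinuousMap.curry ⟨fun p ↦ levelFun m p.1 p.2, continuous_levelFun m⟩

lemma levelMap_apply (m : ℕ) (ξ : ℕ × ℕ → ℝ) (t : ℝ≥0) : levelMap m ξ t = levelFun m ξ t := rfl

/-- The law of a double sequence of independent standard Gaussian variables. -/
noncomputable def gaussianSeq : Measure (ℕ × ℕ → ℝ) :=
  Measure.infinitePi fun _ ↦ gaussianReal 0 1

instance : IsProbabilityMeasure gaussianSeq := by unfold gaussianSeq; infer_instance

lemma iIndepFun_gaussianSeq :
    iIndepFun (fun (i : ℕ × ℕ) (ξ : ℕ × ℕ → ℝ) ↦ ξ i) gaussianSeq :=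
  iIndepFun_infinitePi (X := fun _ x ↦ x) (fun _ ↦ measurable_id)

lemma hasLaw_gaussianSeq (i : ℕ × ℕ) :
    HasLaw (fun ξ : ℕ × ℕ → ℝ ↦ ξ i) (gaussianReal 0 1) gaussianSeq :=
  (measurePreserving_eval_infinitePi (fun _ ↦ gaussianReal 0 1) i).hasLaw

lemma memLp_gaussianSeq (i : ℕ × ℕ) : MemLp (fun ξ : ℕ × ℕ → ℝ ↦ ξ i) 2 gaussianSeq :=
  ((hasLaw_gaussianSeq i).hasGaussianLaw).memLp_two

lemma covariance_gaussianSeq (i j : ℕ × ℕ) :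
    cov[fun ξ : ℕ × ℕ → ℝ ↦ ξ i, fun ξ ↦ ξ j; gaussianSeq] = if i = j then 1 else 0 := by
  split_ifs with h
  · subst h
    rw [covariance_self (hasLaw_gaussianSeq i).aemeasurable, (hasLaw_gaussianSeq i).variance_eq,
      variance_id_gaussianReal]
    simp
  · exact (iIndepFun_gaussianSeq.indepFun h).covariance_eq_zero (memLp_gaussianSeq i)
      (memLp_gaussianSeq j)

lemma isGaussianProcess_gaussianSeq :
    IsGaussianProcess (fun (i : ℕ × ℕ) (ξ : ℕ × ℕ → ℝ) ↦ ξ i) gaussianSeq where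
  hasGaussianLaw I :=
    iIndepFun.hasGaussianLaw (X := fun (i : I) (ξ : ℕ × ℕ → ℝ) ↦ ξ i)
      (fun i ↦ (hasLaw_gaussianSeq i).hasGaussianLaw)
      (iIndepFun_gaussianSeq.precomp Subtype.val_injective)

/-- Partial sums of the Lévy–Ciesielski series. -/
noncomputable def partialSum (n : ℕ) (t : ℝ≥0) (ξ : ℕ × ℕ → ℝ) : ℝ :=
  ∑ m ∈ Finset.range (n + 1), levelFun m ξ t

lemma partialSum_eq {n N : ℕ} {t : ℝ≥0} (hN : 2 ^ n * (t : ℝ) ≤ N) (ξ : ℕ × ℕ → ℝ) :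
    partialSum n t ξ = ∑ i ∈ Finset.range (n + 1) ×ˢ Finset.range N,
      schauder i.1 i.2 t * ξ i := by
  rw [Finset.sum_product, partialSum]
  refine Finset.sum_congr rfl fun m hm ↦ ?_
  have hm : m ≤ n := Nat.lt_succ_iff.1 (Finset.mem_range.1 hm)
  rw [levelFun_eq (N := N)]
  · exact Finset.sum_congr rfl fun k _ ↦ mul_comm _ _
  · refine le_trans ?_ hN
    gcongr
    norm_num

lemma isGaussianProcess_partialSum (n : ℕ) : IsGaussianProcess (partialSum n) gaussianSeq := by
  refine isGaussianProcess_gaussianSeq.of_isGaussianProcess fun t ↦ ?_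
  obtain ⟨N, hN⟩ := exists_nat_ge (2 ^ n * (t : ℝ))
  refine ⟨Finset.range (n + 1) ×ˢ Finset.range N,
    ∑ i : (Finset.range (n + 1) ×ˢ Finset.range N : Finset (ℕ × ℕ)),
      schauder i.1.1 i.1.2 t • ContinuousLinearMap.proj (R := ℝ) i, fun ξ ↦ ?_⟩
  rw [partialSum_eq hN, ← Finset.sum_coe_sort]
  simp

lemma integral_partialSum (n : ℕ) (t : ℝ≥0) : ∫ ξ, partialSum n t ξ ∂gaussianSeq = 0 := by
  obtain ⟨N, hN⟩ := exists_nat_ge (2 ^ n * (t : ℝ))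
  simp_rw [partialSum_eq hN]
  rw [integral_finsetSum _ fun i _ ↦ ((memLp_gaussianSeq i).integrable one_le_two).const_mul _]
  refine Finset.sum_eq_zero fun i _ ↦ ?_
  rw [integral_const_mul, (hasLaw_gaussianSeq i).integral_eq, integral_id_gaussianReal, mul_zero]

lemma covariance_partialSum {n N : ℕ} {s t : ℝ≥0} (hs : 2 ^ n * (s : ℝ) ≤ N)
    (ht : 2 ^ n * (t : ℝ) ≤ N) :
    cov[partialSum n s, partialSum n t; gaussianSeq] =
      ∑ m ∈ Finset.range (n + 1), ∑ k ∈ Finset.range N, schauder m k s * schauder m k t := by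
  rw [funext (partialSum_eq hs), funext (partialSum_eq ht), covariance_fun_sum_fun_sum'
    (fun i _ ↦ (memLp_gaussianSeq i).const_mul _) (fun i _ ↦ (memLp_gaussianSeq i).const_mul _)]
  refine (Finset.sum_product _ _ _).trans ?_
  refine Finset.sum_congr rfl fun m hm ↦ Finset.sum_congr rfl fun k hk ↦ ?_
  simp_rw [covariance_const_mul_left, covariance_const_mul_right, covariance_gaussianSeq]
  rw [Finset.sum_eq_single_of_mem (m, k) (Finset.mem_product.2 ⟨hm, hk⟩)]
  · simp
  · intro j _ hj
    rw [if_neg hj.symm]; simp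

lemma tendsto_covariance_partialSum (s t : ℝ≥0) :
    Tendsto (fun n ↦ cov[partialSum n s, partialSum n t; gaussianSeq]) atTop
      (𝓝 ((min s t : ℝ≥0) : ℝ)) := by
  wlog hst : s ≤ t generalizing s t
  · simp_rw [covariance_comm (partialSum _ s), min_comm s t]
    exact this t s (le_of_not_ge hst)
  rw [min_eq_left hst]
  have ht (n : ℕ) : 2 ^ n * (t : ℝ) ≤ ⌈2 ^ n * (t : ℝ)⌉₊ := Nat.le_ceil _
  have hs (n : ℕ) : 2 ^ n * (s : ℝ) ≤ ⌈2 ^ n * (t : ℝ)⌉₊ := by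
    refine le_trans ?_ (ht n)
    gcongr
  simp_rw [fun n ↦ covariance_partialSum (hs n) (ht n)]
  exact tendsto_sum_schauder_mul hst hs

lemma levelFun_succ_pow_four_le (m : ℕ) (ξ : ℕ × ℕ → ℝ) {t : ℝ≥0} {T : ℕ} (ht : t ≤ T) :
    levelFun (m + 1) ξ t ^ 4 ≤
      ((4 : ℝ) ^ m)⁻¹ * ∑ k ∈ Finset.range (2 ^ (m + 1) * T), ξ (m + 1, k) ^ 4 := by
  have ht' : (t : ℝ) ≤ T := by exact_mod_cast ht
  have hN : 2 ^ (m + 1) * (t : ℝ) ≤ (2 ^ (m + 1) * T : ℕ) := by push_cast; gcongr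
  rw [levelFun_eq _ _ hN]
  set k₀ := ⌊2 ^ m * (t : ℝ)⌋₊ with hk₀
  have hpos : (0 : ℝ) ≤ 2 ^ m * t := by positivity
  have hz (k : ℕ) (hk : k ≠ k₀) : schauder (m + 1) k t = 0 := by
    rw [schauder]
    rcases lt_or_gt_of_ne hk with h | h
    · have : (k : ℝ) + 1 ≤ 2 ^ m * t := by
        have : ((k + 1 : ℕ) : ℝ) ≤ 2 ^ m * t := (Nat.le_floor_iff hpos).1 h
        exact_mod_cast this
      rw [tent_of_one_le (by linarith), mul_zero]
    · rw [tent_of_nonpos (by linarith [(Nat.floor_lt hpos).1 h]), mul_zero]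
  have hb (k : ℕ) : schauder (m + 1) k t ^ 4 ≤ ((4 : ℝ) ^ m)⁻¹ := by
    rw [schauder, mul_pow, div_pow, inv_pow, ← pow_mul, mul_comm m 4, pow_mul]
    have h4 : √2 ^ 4 = (4 : ℝ) := by
      rw [show 4 = 2 * 2 by rfl, pow_mul, Real.sq_sqrt (by norm_num)]; norm_num
    rw [h4]
    have h1 : tent (2 ^ m * t - k) ^ 4 ≤ 1 := by
      rw [← Even.pow_abs (by decide)]
      exact pow_le_one₀ (abs_nonneg _) (abs_tent_le_one _)
    have h0 : (0 : ℝ) ≤ tent (2 ^ m * t - k) ^ 4 := by positivity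
    have h5 : (0 : ℝ) < ((4 : ℝ) ^ m)⁻¹ := by positivity
    nlinarith
  by_cases hmem : k₀ ∈ Finset.range (2 ^ (m + 1) * T)
  · rw [Finset.sum_eq_single_of_mem k₀ hmem fun k _ hk ↦ by rw [hz k hk, mul_zero], mul_pow,
      mul_comm]
    have h1 : ξ (m + 1, k₀) ^ 4 ≤ ∑ k ∈ Finset.range (2 ^ (m + 1) * T), ξ (m + 1, k) ^ 4 :=
      Finset.single_le_sum (f := fun k ↦ ξ (m + 1, k) ^ 4) (fun k _ ↦ by positivity) hmem
    exact mul_le_mul (hb k₀) h1 (by positivity) (by positivity)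
  · rw [Finset.sum_eq_zero fun k hk ↦ by
      rw [hz k (fun h ↦ hmem (h ▸ hk)), mul_zero]]
    have : 0 ≤ ∑ k ∈ Finset.range (2 ^ (m + 1) * T), ξ (m + 1, k) ^ 4 :=
      Finset.sum_nonneg fun k _ ↦ by positivity
    simp only [ne_eq, OfNat.ofNat_ne_zero, not_false_eq_true, zero_pow]
    positivity

/-- The bounds on the fourth powers of the levels are almost surely summable, even with the weights
`(5 / 4) ^ m`. Their means are of order `2 ^ m / 4 ^ m`, which leaves room for any ratio below `2`. -/
lemma ae_summable_level_bound (T : ℕ) : ∀ᵐ ξ ∂gaussianSeq,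
    Summable fun m : ℕ ↦ (5 / 4 : ℝ) ^ m *
      (((4 : ℝ) ^ m)⁻¹ * ∑ k ∈ Finset.range (2 ^ (m + 1) * T), ξ (m + 1, k) ^ 4) := by
  set g : ℕ → (ℕ × ℕ → ℝ) → ℝ := fun m ξ ↦ (5 / 4 : ℝ) ^ m *
      (((4 : ℝ) ^ m)⁻¹ * ∑ k ∈ Finset.range (2 ^ (m + 1) * T), ξ (m + 1, k) ^ 4) with hg
  have hg0 (m : ℕ) (ξ : ℕ × ℕ → ℝ) : 0 ≤ g m ξ := by
    have : 0 ≤ ∑ k ∈ Finset.range (2 ^ (m + 1) * T), ξ (m + 1, k) ^ 4 :=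
      Finset.sum_nonneg fun k _ ↦ by positivity
    simp only [hg]; positivity
  have hmeas (m : ℕ) : Measurable (g m) := by simp only [hg]; fun_prop
  have hint (i : ℕ × ℕ) : Integrable (fun ξ : ℕ × ℕ → ℝ ↦ ξ i ^ 4) gaussianSeq ∧
      ∫ ξ, ξ i ^ 4 ∂gaussianSeq = ∫ x, x ^ 4 ∂gaussianReal 0 1 := by
    have h4 : Integrable (fun x : ℝ ↦ x ^ 4) (gaussianReal 0 1) := by
      have h := (memLp_id_gaussianReal (μ := 0) (v := 1) 4).integrable_norm_pow (by norm_num)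
      simpa [Even.pow_abs (show Even 4 by decide)] using h
    refine ⟨?_, ?_⟩
    · rw [← (hasLaw_gaussianSeq i).map_eq] at h4
      exact h4.comp_aemeasurable (hasLaw_gaussianSeq i).aemeasurable
    · exact (hasLaw_gaussianSeq i).integral_comp (f := fun x : ℝ ↦ x ^ 4) (by fun_prop)
  set C := ∫ x, x ^ 4 ∂gaussianReal 0 1 with hC
  have hC0 : 0 ≤ C := integral_nonneg fun x ↦ by positivity
  have hlin (m : ℕ) : ∫⁻ ξ, ENNReal.ofReal (g m ξ) ∂gaussianSeq =
      ENNReal.ofReal ((5 / 8 : ℝ) ^ m * (2 * T * C)) := by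
    have hs : Integrable (fun ξ : ℕ × ℕ → ℝ ↦
        ∑ k ∈ Finset.range (2 ^ (m + 1) * T), ξ (m + 1, k) ^ 4) gaussianSeq :=
      integrable_finsetSum _ fun k _ ↦ (hint _).1
    rw [← ofReal_integral_eq_lintegral_ofReal ((hs.const_mul _).const_mul _)
      (Eventually.of_forall (hg0 m))]
    congr 1
    rw [integral_const_mul, integral_const_mul, integral_finsetSum _ fun k _ ↦ (hint _).1]
    simp only [(hint _).2, Finset.sum_const, Finset.card_range, nsmul_eq_mul]
    push_cast
    have h8 : (5 / 8 : ℝ) ^ m = (5 / 4) ^ m * ((4 ^ m)⁻¹ * 2 ^ m) := by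
      rw [← inv_pow, ← mul_pow, ← mul_pow]; norm_num
    rw [h8, pow_succ]; ring
  have hfin : ∫⁻ ξ, ∑' m, ENNReal.ofReal (g m ξ) ∂gaussianSeq ≠ ∞ := by
    rw [lintegral_tsum fun m ↦ (hmeas m).ennreal_ofReal.aemeasurable]
    simp_rw [hlin]
    exact ((summable_geometric_of_lt_one (by norm_num) (by norm_num)).mul_right
      _).tsum_ofReal_ne_top
  filter_upwards [ae_lt_top (Measurable.tsum fun m ↦ (hmeas m).ennreal_ofReal) hfin]
    with ξ hξ
  have := ENNReal.summable_toReal hξ.ne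
  simpa only [ENNReal.toReal_ofReal (hg0 _ ξ)] using this

lemma ae_summable_levelMap : ∀ᵐ ξ ∂gaussianSeq, Summable fun m ↦ levelMap m ξ := by
  filter_upwards [ae_all_iff.2 ae_summable_level_bound] with ξ hξ
  refine (summable_nat_add_iff 1).1 ?_
  refine ContinuousMap.summable_of_locally_summable_norm fun K ↦ ?_
  obtain ⟨T, hT⟩ : ∃ T : ℕ, ∀ t ∈ K, t ≤ T := by
    obtain ⟨b, hb⟩ := K.isCompact.bddAbove
    obtain ⟨T, hT⟩ := exists_nat_ge b
    exact ⟨T, fun t ht ↦ (hb ht).trans hT⟩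
  have hgeo : Summable fun m : ℕ ↦ (19 / 20 : ℝ) ^ m :=
    summable_geometric_of_lt_one (by norm_num) (by norm_num)
  refine Summable.of_norm_bounded_eventually_nat hgeo ?_
  filter_upwards [(hξ T).tendsto_atTop_zero.eventually_le_const one_pos] with m hm
  rw [norm_norm, ContinuousMap.norm_le _ (by positivity)]
  rintro ⟨t, ht⟩
  have h4 := levelFun_succ_pow_four_le m ξ (hT t ht)
  have hle : levelFun (m + 1) ξ t ^ 4 ≤ ((19 / 20 : ℝ) ^ m) ^ 4 := by
    have h1 : (5 / 4 : ℝ) ^ m * levelFun (m + 1) ξ t ^ 4 ≤ 1 :=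
      (mul_le_mul_of_nonneg_left h4 (by positivity)).trans hm
    -- the ratio `19 / 20` is chosen so that `5 / 4 * (19 / 20) ^ 4 ≥ 1`
    have h2 : (1 : ℝ) ≤ (5 / 4) ^ m * ((19 / 20 : ℝ) ^ m) ^ 4 := by
      rw [← pow_mul, mul_comm m 4, pow_mul, ← mul_pow]
      exact one_le_pow₀ (by norm_num)
    exact le_of_mul_le_mul_left (h1.trans h2) (by positivity)
  rw [← Even.pow_abs (by decide)] at hle
  exact (pow_le_pow_iff_left₀ (abs_nonneg _) (by positivity) (by norm_num)).1 hle

/-- The Wiener measure exists, as the law of the Lévy–Ciesielski series. -/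
theorem exists_isWienerMeasure : ∃ μ : Measure C(ℝ≥0, ℝ), IsWienerMeasure μ := by
  have hmeas (n : ℕ) : Measurable fun ξ ↦ ∑ m ∈ Finset.range (n + 1), levelMap m ξ := by
    have : Continuous fun ξ ↦ ∑ m ∈ Finset.range (n + 1), levelMap m ξ := by fun_prop
    exact this.measurable
  obtain ⟨W, hW, hlim⟩ := measurable_limit_of_tendsto_metrizable_ae (μ := gaussianSeq) (L := atTop)
    (fun n ↦ (hmeas n).aemeasurable) (by
      filter_upwards [ae_summable_levelMap] with ξ hξ
      exact ⟨_, hξ.hasSum.tendsto_sum_nat.comp (tendsto_add_atTop_nat 1)⟩)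
  have hpre : IsPreBrownianReal (fun t ξ ↦ W ξ t) gaussianSeq := by
    refine isPreBrownianReal_of_tendsto isGaussianProcess_partialSum integral_partialSum
      tendsto_covariance_partialSum fun t ↦ ?_
    filter_upwards [hlim] with ξ hξ
    have := ((continuous_eval_const (F := C(ℝ≥0, ℝ)) t).tendsto _).comp hξ
    refine this.congr fun n ↦ ?_
    simp [partialSum, levelMap_apply]
  refine ⟨gaussianSeq.map W, ⟨fun I ↦ ?_⟩⟩
  have hI : Measurable fun x : C(ℝ≥0, ℝ) ↦ I.restrict (fun t ↦ x t) :=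
    measurable_pi_lambda _ fun i ↦ (continuous_eval_const (F := C(ℝ≥0, ℝ)) i.1).measurable
  refine ⟨hI.aemeasurable, ?_⟩
  rw [Measure.map_map hI hW]
  exact (hpre.hasLaw I).map_eq

lemma isWienerMeasure_wienerMeasure : IsWienerMeasure wienerMeasure :=
  Classical.epsilon_spec exists_isWienerMeasure

/-! ### The Brownian motion and the uniform variables -/

instance : IsProbabilityMeasure wienerMeasure :=
  isWienerMeasure_wienerMeasure.isGaussianProcess.isProbabilityMeasure

instance : IsProbabilityMeasure sampleMeasure := by unfold sampleMeasure; infer_instance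

/-- Independence is preserved if an independent coordinate is added to one side. -/
lemma indepFun_prodMk_right_of_prod {α β γ δ : Type*} {mα : MeasurableSpace α}
    {mβ : MeasurableSpace β} {mγ : MeasurableSpace γ} {mδ : MeasurableSpace δ} {μ : Measure α}
    {ρ : Measure β} [IsProbabilityMeasure μ] [IsProbabilityMeasure ρ] {U : α → γ} {V : α → δ}
    (hU : Measurable U) (hV : Measurable V) (h : IndepFun U V μ) :
    IndepFun (fun p : α × β ↦ U p.1) (fun p : α × β ↦ (V p.1, p.2)) (μ.prod ρ) := by
  have := Measure.isProbabilityMeasure_map hU.aemeasurable (μ := μ)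
  have := Measure.isProbabilityMeasure_map hV.aemeasurable (μ := μ)
  have hUV := (indepFun_iff_map_prod_eq_prod_map_map hU.aemeasurable hV.aemeasurable).1 h
  rw [indepFun_iff_map_prod_eq_prod_map_map (by fun_prop) (by fun_prop)]
  have h1 : (μ.prod ρ).map (fun p ↦ U p.1) = μ.map U := by
    rw [← Function.comp_def U Prod.fst, ← Measure.map_map hU measurable_fst]
    simp
  have h2 : (μ.prod ρ).map (fun p ↦ (V p.1, p.2)) = (μ.map V).prod ρ := by
    have := Measure.map_prod_map μ ρ hV measurable_id
    rw [Measure.map_id] at this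
    exact this.symm
  have h3 : (μ.prod ρ).map (fun p ↦ ((U p.1, V p.1), p.2)) = ((μ.map U).prod (μ.map V)).prod ρ := by
    have := Measure.map_prod_map μ ρ (hU.prodMk hV) measurable_id
    rw [Measure.map_id, hUV] at this
    exact this.symm
  rw [h1, h2, ← (measurePreserving_prodAssoc (μ.map U) (μ.map V) ρ).map_eq, ← h3,
    Measure.map_map (by fun_prop) (by fun_prop)]
  rfl

lemma measurePreserving_fst_sampleMeasure :
    MeasurePreserving Prod.fst sampleMeasure wienerMeasure := by
  unfold sampleMeasure; exact measurePreserving_fst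

lemma measurePreserving_snd_sampleMeasure :
    MeasurePreserving Prod.snd sampleMeasure
      (Measure.infinitePi fun _ : ℕ ↦ (volume : Measure unitInterval)) := by
  unfold sampleMeasure; exact measurePreserving_snd

lemma isBrownianReal_coordB : IsBrownianReal coordB sampleMeasure where
  hasLaw I := (isWienerMeasure_wienerMeasure.hasLaw I).comp
    measurePreserving_fst_sampleMeasure.hasLaw
  cont := Eventually.of_forall fun ω ↦ ω.1.continuous

lemma continuous_coordB (ω : SampleSpace) : Continuous fun t ↦ coordB t ω := ω.1.continuous

lemma hasLaw_coordR (n : ℕ) : HasLaw (coordR n) (volume : Measure unitInterval) sampleMeasure :=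
  (measurePreserving_eval_infinitePi (fun _ : ℕ ↦ (volume : Measure unitInterval)) n).hasLaw.comp
    measurePreserving_snd_sampleMeasure.hasLaw

lemma iIndepFun_coordR : iIndepFun coordR sampleMeasure := by
  rw [iIndepFun_iff_map_fun_eq_infinitePi_map (fun n ↦ measurable_coordR n)]
  simp_rw [(hasLaw_coordR _).map_eq]
  exact measurePreserving_snd_sampleMeasure.map_eq

lemma measurable_coordR_zero (n : ℕ) (t : ℝ≥0) : Measurable[sampleFiltration t] (coordR n) := by
  rw [measurable_iff_comap_le]
  exact le_iInf fun ε ↦ le_sup_of_le_left (le_iSup_of_le n le_rfl)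

lemma measurable_coordB_of_le {s t : ℝ≥0} (h : s ≤ t) :
    Measurable[sampleFiltration t] (coordB s) := by
  rw [measurable_iff_comap_le]
  exact le_iInf fun ε ↦ le_sup_of_le_right
    (le_iSup_of_le (⟨s, h.trans le_self_add⟩ : Set.Iic (t + ε.1)) le_rfl)

lemma sampleFiltration_le_rawSigma {s u : ℝ≥0} (h : s < u) : sampleFiltration s ≤ rawSigma u := by
  have := iInf_le (fun ε : {ε : ℝ≥0 // 0 < ε} ↦ rawSigma (s + ε)) ⟨u - s, tsub_pos_of_lt h⟩
  refine this.trans (rawSigma_mono ?_)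
  simp [add_tsub_cancel_of_le h.le]

lemma indepFun_coordB_coordR :
    IndepFun (fun ω (t : ℝ≥0) ↦ coordB t ω) (fun ω n ↦ coordR n ω) sampleMeasure := by
  refine indepFun_prod (X := fun (x : C(ℝ≥0, ℝ)) (t : ℝ≥0) ↦ x t)
    (Y := fun (r : ℕ → unitInterval) n ↦ r n) ?_ measurable_id
  exact measurable_pi_lambda _ fun t ↦ (continuous_eval_const (F := C(ℝ≥0, ℝ)) t).measurable

lemma indep_sub_rawSigma {u t : ℝ≥0} (h : u ≤ t) :
    Indep (MeasurableSpace.comap (fun ω ↦ coordB t ω - coordB u ω) inferInstance) (rawSigma u)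
      sampleMeasure := by
  have hev (t : ℝ≥0) : Measurable fun x : C(ℝ≥0, ℝ) ↦ x t :=
    (continuous_eval_const (F := C(ℝ≥0, ℝ)) t).measurable
  have h1 := isWienerMeasure_wienerMeasure.indepFun_shift u
  have h2 : IndepFun (fun x : C(ℝ≥0, ℝ) ↦ x t - x u) (fun x (s : Set.Iic u) ↦ x s)
      wienerMeasure := by
    have := h1.comp (measurable_pi_apply (t - u)) measurable_id
    simpa [Function.comp_def, add_tsub_cancel_of_le h] using this
  have h3 := indepFun_prodMk_right_of_prod
    (ρ := Measure.infinitePi fun _ : ℕ ↦ (volume : Measure unitInterval))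
    (U := fun x : C(ℝ≥0, ℝ) ↦ x t - x u) (V := fun (x : C(ℝ≥0, ℝ)) (s : Set.Iic u) ↦ x s)
    ((hev t).sub (hev u)) (measurable_pi_lambda _ fun s ↦ hev s) h2
  refine indep_of_indep_of_le_right h3 ?_
  refine sup_le (iSup_le fun n ↦ ?_) (iSup_le fun s ↦ ?_)
  · rintro _ ⟨A, hA, rfl⟩
    exact ⟨{p | p.2 n ∈ A}, ((measurable_pi_apply n).comp measurable_snd) hA, rfl⟩
  · rintro _ ⟨A, hA, rfl⟩
    exact ⟨{p | p.1 s ∈ A}, ((measurable_pi_apply s).comp measurable_fst) hA, rfl⟩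

lemma indep_sub_sampleFiltration {s t : ℝ≥0} (hst : s ≤ t) :
    Indep (MeasurableSpace.comap (fun ω ↦ coordB t ω - coordB s ω) inferInstance)
      (sampleFiltration s) sampleMeasure := by
  rcases hst.eq_or_lt with rfl | hlt
  · simp only [sub_self, MeasurableSpace.comap_const]
    exact indep_bot_left _
  -- the increments over `[u n, t]`, with `u n` decreasing to `s`, are independent of the σ-algebra
  -- at `s`, and independence passes to the limit when tested with bounded continuous functions
  refine Indep.symm (indep_comap_of_bcf (sampleFiltration.le s)
    ((measurable_coordB t).sub (measurable_coordB s)).aemeasurable fun A hA f ↦ ?_)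
  obtain ⟨u, -, hu, hlim⟩ := exists_seq_strictAnti_tendsto' hlt
  have hmeas (v : ℝ≥0) : Measurable fun ω ↦ coordB t ω - coordB v ω :=
    (measurable_coordB t).sub (measurable_coordB v)
  have hn (n : ℕ) : ∫ ω in A, f (coordB t ω - coordB (u n) ω) ∂sampleMeasure =
      sampleMeasure.real A * ∫ ω, f (coordB t ω - coordB (u n) ω) ∂sampleMeasure := by
    have hA' : MeasurableSet[rawSigma (u n)] A := sampleFiltration_le_rawSigma (hu n).1 A hA
    exact (indep_sub_rawSigma (hu n).2.le).symm.setIntegral_eq_mul (rawSigma_le _)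
      (hmeas _).aemeasurable hA' f.continuous.measurable.aestronglyMeasurable
  have hconv (ν : Measure SampleSpace) [IsFiniteMeasure ν] :
      Tendsto (fun n ↦ ∫ ω, f (coordB t ω - coordB (u n) ω) ∂ν) atTop
        (𝓝 (∫ ω, f (coordB t ω - coordB s ω) ∂ν)) := by
    refine tendsto_integral_of_dominated_convergence (fun _ ↦ ‖f‖) (fun n ↦ ?_)
      (integrable_const _) (fun n ↦ Eventually.of_forall fun ω ↦ f.norm_coe_le_norm _)
      (Eventually.of_forall fun ω ↦ ?_)
    · exact (f.continuous.measurable.comp (hmeas _)).aestronglyMeasurable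
    · have hc : Continuous fun v ↦ f (coordB t ω - coordB v ω) := by
        have := continuous_coordB ω; fun_prop
      exact (hc.tendsto s).comp hlim
  refine tendsto_nhds_unique (hconv _) ?_
  simp_rw [hn]
  exact (hconv _).const_mul _

lemma isBrownianMotionFor_coordB : IsBrownianMotionFor coordB sampleFiltration sampleMeasure where
  isBrownian := isBrownianReal_coordB
  adapted _ := measurable_coordB_of_le le_rfl
  indep _ _ := indep_sub_sampleFiltration

/-! ### Geometric Brownian motion -/

/-- Geometric Brownian motion at finite times. -/
noncomputable def expBM (t : ℝ≥0) (ω : SampleSpace) : ℝ := Real.exp (coordB t ω - t / 2)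

lemma gbm_coe (t : ℝ≥0) (ω : SampleSpace) : gbm t ω = expBM t ω := rfl

lemma gbm_top (ω : SampleSpace) : gbm ⊤ ω = 0 := rfl

lemma expBM_pos (t : ℝ≥0) (ω : SampleSpace) : 0 < expBM t ω := Real.exp_pos _

lemma gbm_nonneg (t : WithTop ℝ≥0) (ω : SampleSpace) : 0 ≤ gbm t ω := by
  cases t with
  | top => exact (gbm_top ω).ge
  | coe t => exact (expBM_pos t ω).le

lemma continuous_expBM (ω : SampleSpace) : Continuous fun t ↦ expBM t ω := by
  have := continuous_coordB ω
  unfold expBM; fun_prop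

lemma measurable_expBM_of_le {s t : ℝ≥0} (h : s ≤ t) :
    Measurable[sampleFiltration t] (expBM s) :=
  Real.measurable_exp.comp ((measurable_coordB_of_le h).sub_const _)

lemma measurable_expBM (t : ℝ≥0) : Measurable (expBM t) :=
  Real.measurable_exp.comp ((measurable_coordB t).sub_const _)

lemma integral_exp_mul_coordB_sub {s t : ℝ≥0} (h : s ≤ t) (c : ℝ) :
    Integrable (fun ω ↦ Real.exp (c * (coordB t ω - coordB s ω))) sampleMeasure ∧
    ∫ ω, Real.exp (c * (coordB t ω - coordB s ω)) ∂sampleMeasure =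
      Real.exp ((t - s) * c ^ 2 / 2) := by
  have hlaw := isBrownianReal_coordB.toIsPreBrownianReal.hasLaw_sub t s
  have hd : ((nndist t.1 s.1 : ℝ≥0) : ℝ) = t - s := by
    rw [coe_nndist, Real.dist_eq, abs_of_nonneg]
    · rfl
    · exact sub_nonneg.2 (by exact_mod_cast h)
  constructor
  · have := integrable_exp_mul_gaussianReal (μ := 0) (v := nndist t.1 s.1) c
    rw [← hlaw.map_eq] at this
    exact this.comp_aemeasurable hlaw.aemeasurable
  · have h1 := hlaw.integral_comp (f := fun x ↦ Real.exp (c * x))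
      (Measurable.aestronglyMeasurable (by fun_prop))
    have h2 := congrFun (mgf_id_gaussianReal (μ := 0) (v := nndist t.1 s.1)) c
    simp only [mgf, id_eq, hd, zero_mul, zero_add] at h2
    exact h1.trans h2

lemma martingale_expBM : Martingale expBM sampleFiltration sampleMeasure := by
  refine ⟨fun t ↦ (measurable_expBM_of_le le_rfl).stronglyMeasurable, fun s t hst ↦ ?_⟩
  set D : SampleSpace → ℝ := fun ω ↦ Real.exp (1 * (coordB t ω - coordB s ω)) with hD
  have hDm : Measurable[MeasurableSpace.comap (fun ω ↦ coordB t ω - coordB s ω) inferInstance] D :=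
    (Real.measurable_exp.comp (measurable_id.const_mul 1)).comp (comap_measurable _)
  obtain ⟨hDi, hDe⟩ := integral_exp_mul_coordB_sub hst 1
  set c := Real.exp (-((t - s) / 2 : ℝ)) with hc
  have hprod : expBM t = fun ω ↦ (expBM s ω * c) * D ω := by
    ext ω
    simp only [expBM, hD, hc, ← Real.exp_add]
    congr 1; ring
  have hsm : StronglyMeasurable[sampleFiltration s] fun ω ↦ expBM s ω * c :=
    ((measurable_expBM_of_le le_rfl).mul_const c).stronglyMeasurable
  have hti : Integrable (fun ω ↦ (expBM s ω * c) * D ω) sampleMeasure := by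
    rw [← hprod]
    have h0 : ∀ᵐ ω ∂sampleMeasure, coordB 0 ω = 0 :=
      isBrownianReal_coordB.toIsPreBrownianReal.eval_zero_ae_eq_zero
    refine ((integral_exp_mul_coordB_sub (zero_le (a := t)) 1).1.const_mul
      (Real.exp (-(t / 2 : ℝ)))).congr ?_
    filter_upwards [h0] with ω hω
    rw [hω, expBM, ← Real.exp_add]; congr 1; ring
  have h1 := condExp_mul_of_stronglyMeasurable_left hsm hti hDi
  have h2 : sampleMeasure[D | sampleFiltration s] =ᵐ[sampleMeasure]
      fun _ ↦ ∫ ω, D ω ∂sampleMeasure :=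
    condExp_indep_eq ((measurable_coordB t).sub (measurable_coordB s)).comap_le
      (sampleFiltration.le s) hDm.stronglyMeasurable (indep_sub_sampleFiltration hst)
  rw [hprod]
  refine h1.trans ?_
  filter_upwards [h2] with ω hω
  rw [Pi.mul_apply, hω, hDe, mul_assoc, hc, ← Real.exp_add]
  ring_nf
  simp

lemma integrable_expBM (t : ℝ≥0) : Integrable (expBM t) sampleMeasure :=
  martingale_expBM.integrable t

lemma ae_expBM_zero : ∀ᵐ ω ∂sampleMeasure, expBM 0 ω = 1 := by
  filter_upwards [isBrownianReal_coordB.toIsPreBrownianReal.eval_zero_ae_eq_zero] with ω hω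
  simp [expBM, hω]

lemma lintegral_sqrt_expBM (t : ℝ≥0) :
    ∫⁻ ω, ENNReal.ofReal √(expBM t ω) ∂sampleMeasure =
      ENNReal.ofReal (Real.exp (-(t / 8 : ℝ))) := by
  have h0 : ∀ᵐ ω ∂sampleMeasure, coordB 0 ω = 0 :=
    isBrownianReal_coordB.toIsPreBrownianReal.eval_zero_ae_eq_zero
  obtain ⟨hi, he⟩ := integral_exp_mul_coordB_sub (zero_le (a := t)) (1 / 2)
  have heq : (fun ω ↦ ENNReal.ofReal √(expBM t ω)) =ᵐ[sampleMeasure] fun ω ↦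
      ENNReal.ofReal (Real.exp (-(t / 4 : ℝ)) *
        Real.exp (1 / 2 * (coordB t ω - coordB 0 ω))) := by
    filter_upwards [h0] with ω hω
    rw [hω, expBM, ← Real.exp_half, ← Real.exp_add]
    congr 2; ring
  rw [lintegral_congr_ae heq, ← ofReal_integral_eq_lintegral_ofReal (hi.const_mul _)
    (Eventually.of_forall fun ω ↦ by positivity), integral_const_mul, he, ← Real.exp_add]
  congr 2
  simp; ring

/-- Geometric Brownian motion tends to `0` along the integers. -/
lemma ae_tendsto_expBM : ∀ᵐ ω ∂sampleMeasure,
    Tendsto (fun n : ℕ ↦ expBM n ω) atTop (𝓝 0) := by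
  have hm (n : ℕ) : Measurable fun ω ↦ ENNReal.ofReal √(expBM n ω) :=
    (measurable_expBM n).sqrt.ennreal_ofReal
  have hfin : ∫⁻ ω, ∑' n : ℕ, ENNReal.ofReal √(expBM n ω) ∂sampleMeasure ≠ ∞ := by
    rw [lintegral_tsum fun n ↦ (hm n).aemeasurable]
    simp_rw [lintegral_sqrt_expBM]
    have : Summable fun n : ℕ ↦ Real.exp (-((n : ℝ≥0) / 8 : ℝ)) := by
      have h := summable_geometric_of_lt_one (Real.exp_pos (-(1 / 8 : ℝ))).le
        (Real.exp_lt_one_iff.2 (by norm_num))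
      refine h.congr fun n ↦ ?_
      rw [← Real.exp_nat_mul]; congr 1; simp; ring
    exact this.tsum_ofReal_ne_top
  filter_upwards [ae_lt_top (Measurable.tsum hm) hfin] with ω hω
  have h := (ENNReal.summable_toReal hω.ne).tendsto_atTop_zero
  simp only [ENNReal.toReal_ofReal (Real.sqrt_nonneg _)] at h
  have h2 := h.pow 2
  simpa [Real.sq_sqrt (expBM_pos _ _).le] using h2

/-! ### Optional stopping in continuous time -/

section OptionalStopping

variable {Ω : Type*} {mΩ : MeasurableSpace Ω} {P : Measure Ω} {ℱ : Filtration ℝ≥0 mΩ}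

/-- Approximation of `r ≤ T` from above by multiples of `1/(k+1)`, truncated at `T`. -/
noncomputable def gridAbove (T : ℝ≥0) (k : ℕ) (r : ℝ≥0) : ℝ≥0 :=
  min T ((⌊(k + 1) * r⌋₊ + 1) / (k + 1))

lemma le_gridAbove {T r : ℝ≥0} (h : r ≤ T) (k : ℕ) : r ≤ gridAbove T k r := by
  refine le_min h ?_
  rw [le_div_iff₀ (by positivity), mul_comm]
  exact (Nat.lt_floor_add_one _).le

lemma tendsto_gridAbove {T r : ℝ≥0} (h : r ≤ T) :
    Tendsto (fun k ↦ gridAbove T k r) atTop (𝓝 r) := by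
  have hlim : Tendsto (fun k : ℕ ↦ r + 1 / ((k : ℝ≥0) + 1)) atTop (𝓝 r) := by
    simpa using (tendsto_const_nhds (x := r)).add
      (tendsto_one_div_add_atTop_nhds_zero_nat (𝕜 := ℝ≥0))
  refine tendsto_of_tendsto_of_tendsto_of_le_of_le tendsto_const_nhds hlim
    (fun k ↦ le_gridAbove h k) fun k ↦ (min_le_right _ _).trans ?_
  have hk : (0 : ℝ≥0) < k + 1 := by positivity
  rw [div_le_iff₀ hk, add_mul r, one_div_mul_cancel hk.ne', mul_comm r]
  gcongr
  exact Nat.floor_le (by positivity)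

lemma isStoppingTime_gridAbove {ρ : Ω → ℝ≥0} (hρ : IsStoppingTime ℱ fun ω ↦ (ρ ω : WithTop ℝ≥0))
    (T : ℝ≥0) (k : ℕ) : IsStoppingTime ℱ fun ω ↦ (gridAbove T k (ρ ω) : WithTop ℝ≥0) := by
  intro i
  by_cases hT : T ≤ i
  · convert MeasurableSet.univ
    exact Set.eq_univ_of_forall fun ω ↦ WithTop.coe_le_coe.2 ((min_le_left _ _).trans hT)
  · set j : ℝ≥0 := ⌊(k + 1) * i⌋₊ / (k + 1) with hj
    have hji : j ≤ i := by
      rw [hj, div_le_iff₀ (by positivity), mul_comm i]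
      exact Nat.floor_le (by positivity)
    convert hρ.measurableSet_lt_le hji
    rename_i ω
    have : gridAbove T k (ρ ω) ≤ i ↔ ρ ω < j := by
      rw [gridAbove, min_le_iff, or_iff_right hT, div_le_iff₀ (by positivity), mul_comm i, hj,
        lt_div_iff₀ (by positivity), mul_comm (ρ ω)]
      rw [← Nat.floor_lt (by positivity), ← Nat.add_one_le_iff, Nat.le_floor_iff (by positivity)]
      push_cast
      rfl
    exact WithTop.coe_le_coe.trans (this.trans WithTop.coe_lt_coe.symm)

/-- Optional stopping for a martingale with continuous paths and a bounded stopping time. It passes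
from stopping times with countable range to the limit by uniform integrability. -/
theorem setIntegral_stopped_eq [IsFiniteMeasure P] {M : ℝ≥0 → Ω → ℝ} (hM : Martingale M ℱ P)
    (hc : ∀ ω, Continuous fun t ↦ M t ω) {ρ : Ω → ℝ≥0}
    (hρ : IsStoppingTime ℱ fun ω ↦ (ρ ω : WithTop ℝ≥0)) {T : ℝ≥0} (hT : ∀ ω, ρ ω ≤ T) :
    Integrable (fun ω ↦ M (ρ ω) ω) P ∧ ∀ A, MeasurableSet[hρ.measurableSpace] A →
      ∫ ω in A, M (ρ ω) ω ∂P = ∫ ω in A, M T ω ∂P := by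
  have hk (k : ℕ) := isStoppingTime_gridAbove hρ T k
  have hkT (k : ℕ) (ω : Ω) : (gridAbove T k (ρ ω) : WithTop ℝ≥0) ≤ T := by
    exact_mod_cast min_le_left _ _
  have hce (k : ℕ) : P[M T | (hk k).measurableSpace] =ᵐ[P]
      fun ω ↦ M (gridAbove T k (ρ ω)) ω := by
    have hcount : (Set.range fun ω ↦ (gridAbove T k (ρ ω) : WithTop ℝ≥0)).Countable := by
      refine (Set.countable_range fun n : ℕ ↦
        ((min T ((n + 1) / (k + 1)) : ℝ≥0) : WithTop ℝ≥0)).mono ?_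
      rintro _ ⟨ω, rfl⟩
      exact ⟨⌊(k + 1) * ρ ω⌋₊, rfl⟩
    exact (hM.stoppedValue_ae_eq_condExp_of_le_const_of_countable_range (hk k) (hkT k)
      hcount).symm
  have hUI : UniformIntegrable (fun (k : ℕ) ω ↦ M (gridAbove T k (ρ ω)) ω) 1 P :=
    ((hM.integrable T).uniformIntegrable_condExp fun k ↦ (hk k).measurableSpace_le).ae_eq hce
  have hlim : ∀ᵐ ω ∂P, Tendsto (fun k ↦ M (gridAbove T k (ρ ω)) ω) atTop (𝓝 (M (ρ ω) ω)) :=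
    Eventually.of_forall fun ω ↦ ((hc ω).tendsto _).comp (tendsto_gridAbove (hT ω))
  have hmem := hUI.memLp_of_ae_tendsto hlim
  have hint := memLp_one_iff_integrable.1 hmem
  refine ⟨hint, fun A hA ↦ ?_⟩
  have hL1 := tendsto_Lp_finite_of_tendsto_ae le_rfl ENNReal.one_ne_top
    hUI.aestronglyMeasurable hmem hUI.unifIntegrable hlim
  have h1 := tendsto_setIntegral_of_L1' _ hint.aestronglyMeasurable
    (Eventually.of_forall fun k ↦ memLp_one_iff_integrable.1 (hUI.memLp k)) hL1 A
  refine tendsto_nhds_unique h1 (tendsto_const_nhds.congr fun k ↦ ?_)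
  have hle : hρ.measurableSpace ≤ (hk k).measurableSpace :=
    hρ.measurableSpace_mono (hk k) fun ω ↦ by
      show ((ρ ω : ℝ≥0) : WithTop ℝ≥0) ≤ (gridAbove T k (ρ ω) : ℝ≥0)
      exact_mod_cast le_gridAbove (hT ω) k
  rw [← setIntegral_condExp (hk k).measurableSpace_le (hM.integrable T) (hle A hA)]
  exact setIntegral_congr_ae ((hk k).measurableSpace_le A (hle A hA))
    ((hce k).mono fun ω h _ ↦ h)

end OptionalStopping

/-! ### Exit times -/

section ExitTime

variable {Ω : Type*} {mΩ : MeasurableSpace Ω} {ℱ : Filtration ℝ≥0 mΩ}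

/-- The times after `τ` at which `Y` is at or below the barrier `a`, or at or above the barrier
`b`. The upper barrier is active only when `b` is positive. -/
def exitSet (Y : ℝ≥0 → Ω → ℝ) (τ : Ω → WithTop ℝ≥0) (a b : Ω → ℝ) (ω : Ω) : Set ℝ≥0 :=
  {t | τ ω ≤ t ∧ (Y t ω ≤ a ω ∨ (0 < b ω ∧ b ω ≤ Y t ω))}

open Classical in
/-- The first time after `τ` at which `Y` leaves the interval `(a, b)`, or `(a, ∞)` if `b` is not
positive; it is `⊤` if there is no such time. -/
noncomputable def exitTime (Y : ℝ≥0 → Ω → ℝ) (τ : Ω → WithTop ℝ≥0) (a b : Ω → ℝ) (ω : Ω) :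
    WithTop ℝ≥0 :=
  if (exitSet Y τ a b ω).Nonempty then (sInf (exitSet Y τ a b ω) : ℝ≥0) else ⊤

variable {Y : ℝ≥0 → Ω → ℝ} {τ : Ω → WithTop ℝ≥0} {a b : Ω → ℝ} {ω : Ω}

lemma isClosed_exitSet (hc : Continuous fun t ↦ Y t ω) : IsClosed (exitSet Y τ a b ω) := by
  refine IsClosed.inter ?_ ((isClosed_le hc continuous_const).union
    (IsClosed.inter isClosed_const (isClosed_le continuous_const hc)))
  exact isClosed_Ici.preimage WithTop.continuous_coe

lemma exitTime_mem (hc : Continuous fun t ↦ Y t ω) {s : ℝ≥0} (h : exitTime Y τ a b ω = s) :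
    s ∈ exitSet Y τ a b ω := by
  unfold exitTime at h
  split_ifs at h with hne
  · rw [← WithTop.coe_inj.1 h]
    exact (isClosed_exitSet hc).csInf_mem hne (OrderBot.bddBelow _)
  · exact absurd h WithTop.top_ne_coe

lemma exitTime_le {s : ℝ≥0} (h : s ∈ exitSet Y τ a b ω) : exitTime Y τ a b ω ≤ s := by
  unfold exitTime
  rw [if_pos ⟨s, h⟩]
  exact_mod_cast csInf_le (OrderBot.bddBelow _) h

lemma le_exitTime (hc : Continuous fun t ↦ Y t ω) : τ ω ≤ exitTime Y τ a b ω := by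
  cases h : exitTime Y τ a b ω with
  | top => exact le_top
  | coe s => exact (exitTime_mem hc h).1

lemma exitTime_le_iff (hc : Continuous fun t ↦ Y t ω) {t : ℝ≥0} :
    exitTime Y τ a b ω ≤ t ↔ ∃ s ≤ t, s ∈ exitSet Y τ a b ω := by
  refine ⟨fun h ↦ ?_, fun ⟨s, hs, h⟩ ↦ (exitTime_le h).trans (by exact_mod_cast hs)⟩
  obtain ⟨s, hs⟩ := WithTop.ne_top_iff_exists.1 (ne_top_of_le_ne_top (WithTop.coe_ne_top) h)
  exact ⟨s, by rw [← hs] at h; exact_mod_cast h, exitTime_mem hc hs.symm⟩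

lemma lt_of_lt_exitTime {s : ℝ≥0} (hτ : τ ω ≤ s) (h : s < exitTime Y τ a b ω) :
    a ω < Y s ω ∧ (0 < b ω → Y s ω < b ω) := by
  by_contra hcon
  refine absurd (exitTime_le (s := s) ⟨hτ, ?_⟩) (not_le.2 h)
  grind

lemma measurable_indicator_of_stopping (hτ : IsStoppingTime ℱ τ) {f : Ω → ℝ}
    (hf : Measurable[hτ.measurableSpace] f) (q : ℝ≥0) :
    Measurable[ℱ q] ({ω | τ ω ≤ q}.indicator f) := by
  intro S hS
  rw [Set.indicator_preimage, Set.ite]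
  refine MeasurableSet.union ?_ ?_
  · exact (hf hS).2 q
  · exact MeasurableSet.diff (measurable_const hS) (hτ q)

/-- If `τ ≤ t`, then the exit has not happened by time `t` iff the path keeps a uniform distance from
the barriers at `t` and at the times of a countable dense set in `[τ, t]`. -/
lemma exitTime_le_iff_dense (hc : Continuous fun t ↦ Y t ω) (t : ℝ≥0) :
    exitTime Y τ a b ω ≤ t ↔ τ ω ≤ t ∧ ¬ ∃ k : ℕ,
      ∀ q ∈ insert t {q : ℝ≥0 | q ≤ t ∧ q ∈ Set.range (TopologicalSpace.denseSeq ℝ≥0)},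
      τ ω ≤ q → a ω + 1 / (k + 1) ≤ Y q ω ∧ (0 < b ω → Y q ω + 1 / (k + 1) ≤ b ω) := by
  rw [exitTime_le_iff hc]
  constructor
  · rintro ⟨s, hst, hτs, hs⟩
    refine ⟨hτs.trans (by exact_mod_cast hst), ?_⟩
    rintro ⟨k, hk⟩
    have hk0 : (0 : ℝ) < 1 / (k + 1) := by positivity
    have hs' : a ω + 1 / (k + 1) ≤ Y s ω ∧ (0 < b ω → Y s ω + 1 / (k + 1) ≤ b ω) := by
      rcases hst.eq_or_lt with rfl | hlt
      · exact hk s (Set.mem_insert _ _) hτs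
      have hclosed : IsClosed {u | a ω + 1 / (k + 1) ≤ Y u ω ∧
          (0 < b ω → Y u ω + 1 / (k + 1) ≤ b ω)} := by
        refine IsClosed.inter (isClosed_le continuous_const hc) ?_
        by_cases hb : 0 < b ω
        · simp only [hb, forall_const]
          exact isClosed_le (hc.add continuous_const) continuous_const
        · simp only [hb, false_imp_iff]
          exact isClosed_univ
      -- the dense set of times accumulates at `s` from the right
      have hs_mem : s ∈ closure (Set.Ioo s t ∩ Set.range (TopologicalSpace.denseSeq ℝ≥0)) := by
        have h1 := (TopologicalSpace.denseRange_denseSeq ℝ≥0).open_subset_closure_inter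
          (isOpen_Ioo (a := s) (b := t))
        have h2 := closure_mono h1
        rw [closure_closure, closure_Ioo hlt.ne] at h2
        exact h2 ⟨le_rfl, hlt.le⟩
      refine closure_minimal ?_ hclosed hs_mem
      rintro q ⟨⟨h1, h2⟩, hq⟩
      exact hk q (Set.mem_insert_of_mem _ ⟨h2.le, hq⟩) (hτs.trans (by exact_mod_cast h1.le))
    rcases hs with h | ⟨hb, h⟩
    · linarith [hs'.1]
    · linarith [hs'.2 hb]
  · rintro ⟨hτt, hno⟩
    by_contra hcon
    push Not at hcon
    obtain ⟨u, hu⟩ := WithTop.ne_top_iff_exists.1 (ne_top_of_le_ne_top WithTop.coe_ne_top hτt)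
    have hut : u ≤ t := by rw [← hu] at hτt; exact_mod_cast hτt
    have hin (s : ℝ≥0) (hs : s ∈ Set.Icc u t) : a ω < Y s ω ∧ (0 < b ω → Y s ω < b ω) := by
      have := hcon s hs.2
      simp only [exitSet, Set.mem_ofPred_eq, ← hu] at this
      have h1 : (u : WithTop ℝ≥0) ≤ s := by exact_mod_cast hs.1
      grind
    have hne : (Set.Icc u t).Nonempty := ⟨u, le_rfl, hut⟩
    obtain ⟨s₁, hs₁, hmin⟩ := isCompact_Icc.exists_isMinOn hne hc.continuousOn
    obtain ⟨s₂, hs₂, hmax⟩ := isCompact_Icc.exists_isMaxOn hne hc.continuousOn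
    obtain ⟨k₁, hk₁⟩ := exists_nat_one_div_lt (sub_pos.2 (hin s₁ hs₁).1)
    obtain ⟨k₂, hk₂⟩ : ∃ k₂ : ℕ, 0 < b ω → 1 / ((k₂ : ℝ) + 1) < b ω - Y s₂ ω := by
      by_cases hb : 0 < b ω
      · obtain ⟨k₂, hk₂⟩ := exists_nat_one_div_lt (sub_pos.2 ((hin s₂ hs₂).2 hb))
        exact ⟨k₂, fun _ ↦ hk₂⟩
      · exact ⟨0, fun h ↦ absurd h hb⟩
    refine hno ⟨max k₁ k₂, fun q hq hτq ↦ ?_⟩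
    have hqI : q ∈ Set.Icc u t := by
      refine ⟨by rw [← hu] at hτq; exact_mod_cast hτq, ?_⟩
      rcases hq with rfl | ⟨h, -⟩
      exacts [le_rfl, h]
    have e1 : 1 / (((max k₁ k₂ : ℕ) : ℝ) + 1) ≤ 1 / ((k₁ : ℝ) + 1) := by
      gcongr; exact le_max_left _ _
    have e2 : 1 / (((max k₁ k₂ : ℕ) : ℝ) + 1) ≤ 1 / ((k₂ : ℝ) + 1) := by
      gcongr; exact le_max_right _ _
    have m1 : Y s₁ ω ≤ Y q ω := hmin hqI
    have m2 : Y q ω ≤ Y s₂ ω := hmax hqI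
    exact ⟨by linarith, fun hb ↦ by linarith [hk₂ hb]⟩

theorem isStoppingTime_exitTime (hc : ∀ ω, Continuous fun t ↦ Y t ω)
    (hY : ∀ t, Measurable[ℱ t] (Y t)) (hτ : IsStoppingTime ℱ τ)
    (ha : Measurable[hτ.measurableSpace] a) (hb : Measurable[hτ.measurableSpace] b) :
    IsStoppingTime ℱ (exitTime Y τ a b) := by
  intro t
  set D : Set ℝ≥0 := insert t {q : ℝ≥0 | q ≤ t ∧ q ∈ Set.range (TopologicalSpace.denseSeq ℝ≥0)}
    with hD
  have hcount : D.Countable :=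
    Set.Countable.insert _ ((Set.countable_range _).mono fun q hq ↦ hq.2)
  have heq : {ω | exitTime Y τ a b ω ≤ t} = {ω | τ ω ≤ t} ∩ (⋃ k : ℕ, ⋂ q ∈ D,
      {ω | τ ω ≤ q → a ω + 1 / ((k : ℝ) + 1) ≤ Y q ω ∧
        (0 < b ω → Y q ω + 1 / ((k : ℝ) + 1) ≤ b ω)})ᶜ := by
    ext ω
    simp only [Set.mem_inter_iff, Set.mem_compl_iff, Set.mem_iUnion, Set.mem_iInter]
    exact exitTime_le_iff_dense (hc ω) t
  rw [heq]
  refine (hτ t).inter (MeasurableSet.compl ?_)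
  refine MeasurableSet.iUnion fun k ↦ MeasurableSet.biInter hcount fun q hq ↦ ?_
  have hqt : q ≤ t := by
    rcases hq with rfl | ⟨h, -⟩
    exacts [le_rfl, h]
  refine ℱ.mono hqt _ ?_
  have hA := measurable_indicator_of_stopping hτ ha q
  have hB := measurable_indicator_of_stopping hτ hb q
  have : {ω | τ ω ≤ q → a ω + 1 / ((k : ℝ) + 1) ≤ Y q ω ∧
        (0 < b ω → Y q ω + 1 / ((k : ℝ) + 1) ≤ b ω)} =
      {ω | τ ω ≤ q}ᶜ ∪ ({ω | {ω | τ ω ≤ q}.indicator a ω + 1 / ((k : ℝ) + 1) ≤ Y q ω} ∩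
        ({ω | 0 < {ω | τ ω ≤ q}.indicator b ω}ᶜ ∪
          {ω | Y q ω + 1 / ((k : ℝ) + 1) ≤ {ω | τ ω ≤ q}.indicator b ω})) := by
    ext ω
    simp only [Set.mem_union, Set.mem_compl_iff, Set.mem_inter_iff, Set.mem_ofPred_eq]
    by_cases h : ω ∈ {ω | τ ω ≤ q}
    · rw [Set.indicator_of_mem h, Set.indicator_of_mem h]
      exact ⟨fun h' ↦ .inr ⟨(h' h).1, imp_iff_not_or.1 (h' h).2⟩, fun h' _ ↦
        ⟨(h'.resolve_left (not_not.2 h)).1, imp_iff_not_or.2 (h'.resolve_left (not_not.2 h)).2⟩⟩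
    · exact ⟨fun _ ↦ .inl h, fun _ h' ↦ absurd h' h⟩
  rw [this]
  refine (hτ q).compl.union (MeasurableSet.inter ?_ (MeasurableSet.union ?_ ?_))
  · exact measurableSet_le (hA.add_const _) (hY q)
  · exact (measurableSet_lt measurable_const hB).compl
  · exact measurableSet_le ((hY q).add_const _) hB

end ExitTime

/-! ### The law of geometric Brownian motion at an exit time -/

section ExitLaw

/-- `min τ T`, as a finite time. -/
noncomputable def truncTime {Ω : Type*} (τ : Ω → WithTop ℝ≥0) (T : ℝ≥0) (ω : Ω) : ℝ≥0 :=
  (min (τ ω) T).untopD 0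

lemma coe_truncTime {Ω : Type*} (τ : Ω → WithTop ℝ≥0) (T : ℝ≥0) (ω : Ω) :
    (truncTime τ T ω : WithTop ℝ≥0) = min (τ ω) T := by
  unfold truncTime
  have hne := ne_top_of_le_ne_top WithTop.coe_ne_top (min_le_right (τ ω) (T : WithTop ℝ≥0))
  obtain ⟨t, ht⟩ := WithTop.ne_top_iff_exists.1 hne
  rw [← ht, WithTop.untopD_coe]

lemma truncTime_le {Ω : Type*} (τ : Ω → WithTop ℝ≥0) (T : ℝ≥0) (ω : Ω) :
    truncTime τ T ω ≤ T := by
  rw [← WithTop.coe_le_coe, coe_truncTime]; exact min_le_right _ _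

lemma truncTime_of_le {Ω : Type*} {τ : Ω → WithTop ℝ≥0} {T t : ℝ≥0} {ω : Ω} (h : τ ω = t)
    (htT : t ≤ T) : truncTime τ T ω = t := by
  rw [← WithTop.coe_inj, coe_truncTime, h]; exact min_eq_left (by exact_mod_cast htT)

lemma truncTime_of_ge {Ω : Type*} {τ : Ω → WithTop ℝ≥0} {T : ℝ≥0} {ω : Ω} (h : T ≤ τ ω) :
    truncTime τ T ω = T := by
  rw [← WithTop.coe_inj, coe_truncTime]; exact min_eq_right h

lemma isStoppingTime_truncTime {Ω : Type*} {mΩ : MeasurableSpace Ω} {ℱ : Filtration ℝ≥0 mΩ}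
    {τ : Ω → WithTop ℝ≥0} (hτ : IsStoppingTime ℱ τ) (T : ℝ≥0) :
    IsStoppingTime ℱ fun ω ↦ (truncTime τ T ω : WithTop ℝ≥0) := by
  simp_rw [coe_truncTime]
  exact hτ.min_const T

lemma measurableSet_truncTime {Ω : Type*} {mΩ : MeasurableSpace Ω} {ℱ : Filtration ℝ≥0 mΩ}
    {τ : Ω → WithTop ℝ≥0} (hτ : IsStoppingTime ℱ τ) {T : ℝ≥0} {A : Set Ω}
    (hA : MeasurableSet[hτ.measurableSpace] A) (hAT : ∀ ω ∈ A, τ ω ≤ T) :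
    MeasurableSet[(isStoppingTime_truncTime hτ T).measurableSpace] A := by
  have h : A = A ∩ {ω | τ ω ≤ T} := (Set.inter_eq_left.2 hAT).symm
  have h1 := hτ.measurableSet_inter_le (isStoppingTime_const ℱ T) A hA
  rw [← h] at h1
  refine IsStoppingTime.measurableSpace_mono _ (isStoppingTime_truncTime hτ T) ?_ _ h1
  intro ω
  exact (coe_truncTime τ T ω).ge

variable {ℋ : Filtration ℝ≥0 (inferInstance : MeasurableSpace SampleSpace)}
  {τ : SampleSpace → WithTop ℝ≥0} {a b : SampleSpace → ℝ}

lemma measurable_gbm_stopped (hM : Martingale expBM ℋ sampleMeasure) (hτ : IsStoppingTime ℋ τ) :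
    Measurable[hτ.measurableSpace] fun ω ↦ gbm (τ ω) ω := by
  have h1 := measurable_stoppedValue
    (hM.stronglyAdapted.isStronglyProgressive_of_continuous continuous_expBM) hτ
  have h2 : MeasurableSet[hτ.measurableSpace] {ω | τ ω = ⊤} :=
    hτ.measurable (measurableSet_singleton ⊤)
  have : (fun ω ↦ gbm (τ ω) ω) = {ω | τ ω = ⊤}ᶜ.indicator (stoppedValue expBM τ) := by
    ext ω
    cases h : τ ω with
    | top => rw [Set.indicator_of_notMem (by simpa using h), gbm_top]
    | coe t =>
      have hmem : ω ∈ {ω | τ ω = ⊤}ᶜ := fun h' ↦ WithTop.coe_ne_top (h.symm.trans h')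
      rw [Set.indicator_of_mem hmem, gbm_coe, stoppedValue, h]
      rfl
  rw [this]
  exact Measurable.indicator h1 h2.compl

/-- Almost surely, geometric Brownian motion started between the barriers sits on a barrier at the
exit time. If it never exits, then its limit `0` is the lower barrier. -/
lemma gbm_exitTime_mem {ω : SampleSpace} (hlim : Tendsto (fun n : ℕ ↦ expBM n ω) atTop (𝓝 0))
    (ha : 0 ≤ a ω) (hax : a ω ≤ gbm (τ ω) ω) (hxb : 0 < b ω → gbm (τ ω) ω < b ω) :
    gbm (exitTime expBM τ a b ω) ω = a ω ∨
      (0 < b ω ∧ gbm (exitTime expBM τ a b ω) ω = b ω) := by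
  have hc := continuous_expBM ω
  cases hs : exitTime expBM τ a b ω with
  | top =>
    left
    rw [gbm_top]
    refine le_antisymm ha ?_
    cases hτ : τ ω with
    | top => simpa [hτ, gbm_top] using hax
    | coe u =>
      refine ge_of_tendsto hlim ?_
      filter_upwards [eventually_ge_atTop ⌈u⌉₊] with n hn
      have hun : u ≤ n := (Nat.le_ceil u).trans (by exact_mod_cast hn)
      refine (lt_of_lt_exitTime (τ := τ) (b := b) (s := n) ?_ ?_).1.le
      · rw [hτ]; exact WithTop.coe_le_coe.2 hun
      · rw [hs]; exact WithTop.coe_lt_top _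
  | coe s =>
    have hmem := exitTime_mem hc hs
    obtain ⟨u, hu⟩ := WithTop.ne_top_iff_exists.1 (ne_top_of_le_ne_top WithTop.coe_ne_top hmem.1)
    rw [← hu, gbm_coe] at hax hxb
    rw [gbm_coe]
    have hus : u ≤ s := by have := hmem.1; rw [← hu] at this; exact_mod_cast this
    have hle : a ω ≤ expBM s ω ∧ (0 < b ω → expBM s ω ≤ b ω) := by
      rcases hus.eq_or_lt with rfl | hlt
      · exact ⟨hax, fun h ↦ (hxb h).le⟩
      have hin (r : ℝ≥0) (hr : r ∈ Set.Ico u s) :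
          a ω < expBM r ω ∧ (0 < b ω → expBM r ω < b ω) := by
        refine lt_of_lt_exitTime (τ := τ) ?_ ?_
        · rw [← hu]; exact_mod_cast hr.1
        · rw [hs]; exact_mod_cast hr.2
      have hscl : s ∈ closure (Set.Ico u s) := by
        rw [closure_Ico hlt.ne]; exact ⟨hlt.le, le_rfl⟩
      refine ⟨closure_minimal (fun r hr ↦ (hin r hr).1.le) (isClosed_le continuous_const hc) hscl,
        fun hb ↦ closure_minimal (fun r hr ↦ ((hin r hr).2 hb).le)
          (isClosed_le hc continuous_const) hscl⟩
    rcases hmem.2 with h | ⟨hb, h⟩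
    · exact .inl (le_antisymm h hle.1)
    · exact .inr ⟨hb, le_antisymm (hle.2 hb) h⟩

lemma tendsto_expBM_truncTime {ω : SampleSpace}
    (hlim : Tendsto (fun n : ℕ ↦ expBM n ω) atTop (𝓝 0)) :
    Tendsto (fun n : ℕ ↦ expBM (truncTime τ n ω) ω) atTop (𝓝 (gbm (τ ω) ω)) := by
  cases h : τ ω with
  | top =>
    rw [gbm_top]
    refine hlim.congr fun n ↦ ?_
    rw [truncTime_of_ge (by rw [h]; exact le_top)]
  | coe t =>
    refine tendsto_const_nhds.congr' ?_
    filter_upwards [eventually_ge_atTop ⌈t⌉₊] with n hn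
    rw [truncTime_of_le h ((Nat.le_ceil t).trans (by exact_mod_cast hn)), gbm_coe]

/-- The value of geometric Brownian motion stays below the upper barrier up to the exit time. -/
lemma expBM_truncTime_exitTime_le {ω : SampleSpace}
    (hlim : Tendsto (fun n : ℕ ↦ expBM n ω) atTop (𝓝 0))
    (ha : 0 ≤ a ω) (hax : a ω ≤ gbm (τ ω) ω) (hb : 0 < b ω) (hxb : gbm (τ ω) ω < b ω)
    {T : ℝ≥0} (hT : τ ω ≤ T) : expBM (truncTime (exitTime expBM τ a b) T ω) ω ≤ b ω := by
  rcases lt_or_ge (T : WithTop ℝ≥0) (exitTime expBM τ a b ω) with h | h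
  · rw [truncTime_of_ge h.le]
    exact ((lt_of_lt_exitTime hT h).2 hb).le
  · obtain ⟨s, hs⟩ := WithTop.ne_top_iff_exists.1 (ne_top_of_le_ne_top WithTop.coe_ne_top h)
    rw [truncTime_of_le hs.symm (by rw [← hs] at h; exact_mod_cast h), ← gbm_coe, hs]
    rcases gbm_exitTime_mem hlim ha hax (fun _ ↦ hxb) with h | ⟨-, h⟩ <;> rw [h]
    exact hax.trans hxb.le

/-- Optional stopping at an exit time, on an event on which the path is bounded. -/
lemma setIntegral_gbm_exitTime (hM : Martingale expBM ℋ sampleMeasure) (hτ : IsStoppingTime ℋ τ)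
    (ham : Measurable[hτ.measurableSpace] a) (hbm : Measurable[hτ.measurableSpace] b)
    (hab : ∀ᵐ ω ∂sampleMeasure, 0 ≤ a ω ∧ a ω ≤ gbm (τ ω) ω ∧ (0 < b ω → gbm (τ ω) ω < b ω))
    {A : Set SampleSpace} (hA : MeasurableSet[hτ.measurableSpace] A) (N : ℕ)
    (hAN : ∀ ω ∈ A, 0 < b ω ∧ b ω ≤ N ∧ τ ω ≤ (N : ℝ≥0)) :
    ∫ ω in A, gbm (exitTime expBM τ a b ω) ω ∂sampleMeasure =
      ∫ ω in A, gbm (τ ω) ω ∂sampleMeasure := by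
  have hσ : IsStoppingTime ℋ (exitTime expBM τ a b) :=
    isStoppingTime_exitTime continuous_expBM (fun t ↦ (hM.stronglyAdapted t).measurable) hτ ham hbm
  set σ := exitTime expBM τ a b
  have hA0 : MeasurableSet A := hτ.measurableSpace_le A hA
  have hstep (n : ℕ) (hn : N ≤ n) :
      ∫ ω in A, expBM (truncTime σ n ω) ω ∂sampleMeasure =
        ∫ ω in A, gbm (τ ω) ω ∂sampleMeasure := by
    have hτn (ω) (hω : ω ∈ A) : τ ω ≤ (n : ℝ≥0) := (hAN ω hω).2.2.trans (by exact_mod_cast hn)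
    have hAτ := measurableSet_truncTime hτ hA hτn
    have hAσ : MeasurableSet[(isStoppingTime_truncTime hσ n).measurableSpace] A := by
      refine IsStoppingTime.measurableSpace_mono _ _ (fun ω ↦ ?_) _ hAτ
      show (truncTime τ n ω : WithTop ℝ≥0) ≤ truncTime σ n ω
      rw [coe_truncTime, coe_truncTime]
      exact min_le_min_right _ (le_exitTime (continuous_expBM ω))
    rw [(setIntegral_stopped_eq hM continuous_expBM _ (truncTime_le σ n)).2 A hAσ,
      ← (setIntegral_stopped_eq hM continuous_expBM _ (truncTime_le τ n)).2 A hAτ]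
    refine setIntegral_congr_fun hA0 fun ω hω ↦ ?_
    obtain ⟨t, ht⟩ := WithTop.ne_top_iff_exists.1
      (ne_top_of_le_ne_top WithTop.coe_ne_top (hτn ω hω))
    have htn := hτn ω hω
    rw [← ht] at htn
    show expBM (truncTime τ n ω) ω = gbm (τ ω) ω
    rw [truncTime_of_le ht.symm (by exact_mod_cast htn), ← ht, gbm_coe]
  have hlim : Tendsto (fun n : ℕ ↦ ∫ ω in A, expBM (truncTime σ n ω) ω ∂sampleMeasure) atTop
      (𝓝 (∫ ω in A, gbm (σ ω) ω ∂sampleMeasure)) := by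
    refine tendsto_integral_filter_of_dominated_convergence (fun _ ↦ (N : ℝ)) ?_ ?_
      (integrable_const _) ?_
    · refine Eventually.of_forall fun n ↦ ?_
      exact ((setIntegral_stopped_eq hM continuous_expBM (isStoppingTime_truncTime hσ n)
        (truncTime_le σ n)).1.aestronglyMeasurable).restrict
    · filter_upwards [eventually_ge_atTop N] with n hn
      filter_upwards [ae_restrict_mem hA0, ae_restrict_of_ae hab,
        ae_restrict_of_ae ae_tendsto_expBM] with ω hω h hl
      rw [Real.norm_of_nonneg (expBM_pos _ _).le]
      obtain ⟨hb, hbN, hτN⟩ := hAN ω hω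
      exact (expBM_truncTime_exitTime_le hl h.1 h.2.1 hb (h.2.2 hb)
        (hτN.trans (by exact_mod_cast hn))).trans hbN
    · exact ae_restrict_of_ae (ae_tendsto_expBM.mono fun ω h ↦ tendsto_expBM_truncTime h)
  refine tendsto_nhds_unique hlim (tendsto_const_nhds.congr' ?_)
  filter_upwards [eventually_ge_atTop N] with n hn
  exact (hstep n hn).symm

end ExitLaw

section ExitLaw

/-- Two functions with the same integrals over the sets of a sub-σ-algebra have the same integrals
against the functions measurable for that σ-algebra. The integrals need only agree on the sets
contained in a member of an increasing sequence that exhausts the set where the functions differ. -/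
lemma lintegral_mul_eq_of_forall_setLIntegral_eq {Ω : Type*} {m m0 : MeasurableSpace Ω}
    (hm : m ≤ m0) {μ : Measure Ω} {f g φ : Ω → ℝ≥0∞} (hf : Measurable f) (hg : Measurable g)
    (hφ : Measurable[m] φ) {C : ℕ → Set Ω} (hC : ∀ N, MeasurableSet[m] (C N)) (hmono : Monotone C)
    (hfg : ∀ᵐ ω ∂μ, (∃ N, ω ∈ C N) ∨ f ω = g ω)
    (h : ∀ N A, MeasurableSet[m] A → A ⊆ C N → ∫⁻ ω in A, f ω ∂μ = ∫⁻ ω in A, g ω ∂μ) :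
    ∫⁻ ω, φ ω * f ω ∂μ = ∫⁻ ω, φ ω * g ω ∂μ := by
  have key (A : Set Ω) (hA : MeasurableSet[m] A) :
      ∫⁻ ω in A, f ω ∂μ = ∫⁻ ω in A, g ω ∂μ := by
    have hU : MeasurableSet[m] (⋃ N, C N) := MeasurableSet.iUnion hC
    rw [← lintegral_inter_add_sdiff f A (hm _ hU), ← lintegral_inter_add_sdiff g A (hm _ hU)]
    congr 1
    · have hdir : Directed (· ⊆ ·) fun N ↦ A ∩ C N :=
        Monotone.directed_le fun i j hij ↦ Set.inter_subset_inter_right _ (hmono hij)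
      rw [Set.inter_iUnion, setLIntegral_iUnion_of_directed f hdir,
        setLIntegral_iUnion_of_directed g hdir]
      exact iSup_congr fun N ↦ h N _ (hA.inter (hC N)) Set.inter_subset_right
    · refine setLIntegral_congr_fun_ae (hm _ (hA.diff hU)) ?_
      filter_upwards [hfg] with ω hω hmem
      exact hω.resolve_left fun ⟨N, hN⟩ ↦ hmem.2 (Set.mem_iUnion.2 ⟨N, hN⟩)
  have htrim : (μ.withDensity f).trim hm = (μ.withDensity g).trim hm := by
    refine @Measure.ext _ m _ _ fun A hA ↦ ?_
    rw [trim_measurableSet_eq hm hA, trim_measurableSet_eq hm hA,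
      withDensity_apply _ (hm _ hA), withDensity_apply _ (hm _ hA), key A hA]
  have h1 := lintegral_withDensity_eq_lintegral_mul μ hf (hφ.mono hm le_rfl)
  have h2 := lintegral_withDensity_eq_lintegral_mul μ hg (hφ.mono hm le_rfl)
  simp only [Pi.mul_apply, mul_comm (f _), mul_comm (g _)] at h1 h2
  rw [← h1, ← h2, ← lintegral_trim hm hφ, ← lintegral_trim hm hφ, htrim]

lemma lintegral_ofReal_sub {Ω : Type*} {mΩ : MeasurableSpace Ω} {μ : Measure Ω} {f g : Ω → ℝ}
    (hf : Integrable f μ) (hg : Integrable g μ) (h : ∀ᵐ ω ∂μ, g ω ≤ f ω) :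
    ∫⁻ ω, ENNReal.ofReal (f ω - g ω) ∂μ = ENNReal.ofReal (∫ ω, f ω ∂μ - ∫ ω, g ω ∂μ) := by
  rw [← integral_sub hf hg]
  exact (ofReal_integral_eq_lintegral_ofReal (hf.sub hg)
    (h.mono fun ω h ↦ sub_nonneg.2 h)).symm

variable {ℋ : Filtration ℝ≥0 (inferInstance : MeasurableSpace SampleSpace)}
  {τ : SampleSpace → WithTop ℝ≥0} {a b : SampleSpace → ℝ}

/-- Optional stopping at the exit time, tested against the past of `τ`. -/
lemma lintegral_mul_gbm_exitTime (hM : Martingale expBM ℋ sampleMeasure)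
    (hτ : IsStoppingTime ℋ τ)
    (ham : Measurable[hτ.measurableSpace] a) (hbm : Measurable[hτ.measurableSpace] b)
    (hab : ∀ᵐ ω ∂sampleMeasure, 0 ≤ a ω ∧ a ω ≤ gbm (τ ω) ω ∧ (0 < b ω → gbm (τ ω) ω < b ω))
    {φ : SampleSpace → ℝ≥0∞} (hφ : Measurable[hτ.measurableSpace] φ) :
    ∫⁻ ω in {ω | 0 < b ω}, φ ω * ENNReal.ofReal (gbm (exitTime expBM τ a b ω) ω - a ω)
        ∂sampleMeasure =
      ∫⁻ ω in {ω | 0 < b ω}, φ ω * ENNReal.ofReal (gbm (τ ω) ω - a ω) ∂sampleMeasure ∧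
    ∫⁻ ω in {ω | 0 < b ω}, φ ω * ENNReal.ofReal (b ω - gbm (exitTime expBM τ a b ω) ω)
        ∂sampleMeasure =
      ∫⁻ ω in {ω | 0 < b ω}, φ ω * ENNReal.ofReal (b ω - gbm (τ ω) ω) ∂sampleMeasure := by
  have hm := hτ.measurableSpace_le
  have hσ : IsStoppingTime ℋ (exitTime expBM τ a b) :=
    isStoppingTime_exitTime continuous_expBM (fun t ↦ (hM.stronglyAdapted t).measurable) hτ ham hbm
  have hx : Measurable fun ω ↦ gbm (τ ω) ω := (measurable_gbm_stopped hM hτ).mono hm le_rfl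
  have hz : Measurable fun ω ↦ gbm (exitTime expBM τ a b ω) ω :=
    (measurable_gbm_stopped hM hσ).mono hσ.measurableSpace_le le_rfl
  have ha0 : Measurable a := ham.mono hm le_rfl
  have hb0 : Measurable b := hbm.mono hm le_rfl
  have hpos : MeasurableSet[hτ.measurableSpace] {ω | 0 < b ω} :=
    measurableSet_lt measurable_const hbm
  set C : ℕ → Set SampleSpace := fun N ↦ {ω | 0 < b ω} ∩ ({ω | b ω ≤ N} ∩ {ω | τ ω ≤ (N : ℝ≥0)})
  have hC (N : ℕ) : MeasurableSet[hτ.measurableSpace] (C N) :=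
    hpos.inter ((measurableSet_le hbm measurable_const).inter (hτ.measurableSet_le' _))
  have hCmono : Monotone C := by
    intro i j hij ω hω
    have hτj : τ ω ≤ (i : ℝ≥0) := hω.2.2
    have hbj : b ω ≤ j := le_trans hω.2.1 (by exact_mod_cast hij)
    exact ⟨hω.1, hbj, hτj.trans (WithTop.coe_le_coe.2 (by exact_mod_cast hij))⟩
  have hcase : ∀ᵐ ω ∂(sampleMeasure.restrict {ω | 0 < b ω}), (∃ N, ω ∈ C N) ∨
      gbm (exitTime expBM τ a b ω) ω = gbm (τ ω) ω := by
    filter_upwards [ae_restrict_mem (hm _ hpos)] with ω hb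
    cases h : τ ω with
    | top =>
      right
      have := le_exitTime (τ := τ) (a := a) (b := b) (continuous_expBM ω)
      rw [h, top_le_iff] at this
      rw [this]
    | coe t =>
      left
      have hbN : b ω ≤ (max ⌈b ω⌉₊ ⌈t⌉₊ : ℕ) :=
        (Nat.le_ceil _).trans (Nat.cast_le.2 (le_max_left _ _))
      refine ⟨max ⌈b ω⌉₊ ⌈t⌉₊, hb, hbN, ?_⟩
      show τ ω ≤ _
      rw [h]
      exact WithTop.coe_le_coe.2 ((Nat.le_ceil t).trans (Nat.cast_le.2 (le_max_right _ _)))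
  -- on a set in some `C N` everything is bounded, and optional stopping applies
  have hset (N : ℕ) (A : Set SampleSpace) (hA : MeasurableSet[hτ.measurableSpace] A)
      (hAC : A ⊆ C N) :
      IntegrableOn (fun ω ↦ gbm (exitTime expBM τ a b ω) ω) A sampleMeasure ∧
      IntegrableOn (fun ω ↦ gbm (τ ω) ω) A sampleMeasure ∧
      IntegrableOn a A sampleMeasure ∧ IntegrableOn b A sampleMeasure ∧
      ∀ᵐ ω ∂(sampleMeasure.restrict A), a ω ≤ gbm (τ ω) ω ∧ gbm (τ ω) ω ≤ b ω ∧
        a ω ≤ gbm (exitTime expBM τ a b ω) ω ∧ gbm (exitTime expBM τ a b ω) ω ≤ b ω := by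
    have hae : ∀ᵐ ω ∂(sampleMeasure.restrict A), 0 ≤ a ω ∧ b ω ≤ N ∧ a ω ≤ gbm (τ ω) ω ∧
        gbm (τ ω) ω ≤ b ω ∧
        a ω ≤ gbm (exitTime expBM τ a b ω) ω ∧ gbm (exitTime expBM τ a b ω) ω ≤ b ω := by
      filter_upwards [ae_restrict_mem (hm _ hA), ae_restrict_of_ae hab,
        ae_restrict_of_ae ae_tendsto_expBM] with ω hω h hl
      have hb := (hAC hω).1
      have hx' := h.2.2 hb
      refine ⟨h.1, (hAC hω).2.1, h.2.1, hx'.le, ?_⟩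
      rcases gbm_exitTime_mem hl h.1 h.2.1 h.2.2 with h' | ⟨-, h'⟩ <;> rw [h']
      · exact ⟨le_rfl, h.2.1.trans hx'.le⟩
      · exact ⟨h.2.1.trans hx'.le, le_rfl⟩
    have hbd {f : SampleSpace → ℝ} (hf : Measurable f)
        (h : ∀ᵐ ω ∂(sampleMeasure.restrict A), 0 ≤ f ω ∧ f ω ≤ N) :
        IntegrableOn f A sampleMeasure := by
      refine (integrable_const (N : ℝ)).mono' hf.aestronglyMeasurable ?_
      filter_upwards [h] with ω hω
      rw [Real.norm_of_nonneg hω.1]; exact hω.2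
    refine ⟨hbd hz ?_, hbd hx ?_, hbd ha0 ?_, hbd hb0 ?_, ?_⟩
    all_goals filter_upwards [hae] with ω hω
    · exact ⟨by linarith, by linarith⟩
    · exact ⟨by linarith, by linarith⟩
    · exact ⟨by linarith, by linarith⟩
    · exact ⟨by linarith, by linarith⟩
    · exact hω.2.2
  have hrestr {A : Set SampleSpace} {N : ℕ} (hAC : A ⊆ C N) (f : SampleSpace → ℝ≥0∞) :
      ∫⁻ ω in A, f ω ∂(sampleMeasure.restrict {ω | 0 < b ω}) = ∫⁻ ω in A, f ω ∂sampleMeasure := by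
    rw [Measure.restrict_restrict_of_subset]
    exact hAC.trans Set.inter_subset_left
  have hopt (N : ℕ) (A : Set SampleSpace) (hA : MeasurableSet[hτ.measurableSpace] A)
      (hAC : A ⊆ C N) := setIntegral_gbm_exitTime hM hτ ham hbm hab hA N
        fun ω hω ↦ ⟨(hAC hω).1, (hAC hω).2.1, (hAC hω).2.2⟩
  constructor
  · refine lintegral_mul_eq_of_forall_setLIntegral_eq hm (hz.sub ha0).ennreal_ofReal
      (hx.sub ha0).ennreal_ofReal hφ hC hCmono (hcase.mono fun ω h ↦ h.imp_right fun h ↦ by rw [h])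
      fun N A hA hAC ↦ ?_
    obtain ⟨iz, ix, ia, ib, hae⟩ := hset N A hA hAC
    rw [hrestr hAC, hrestr hAC, lintegral_ofReal_sub iz ia (hae.mono fun ω h ↦ h.2.2.1),
      lintegral_ofReal_sub ix ia (hae.mono fun ω h ↦ h.1), hopt N A hA hAC]
  · refine lintegral_mul_eq_of_forall_setLIntegral_eq hm (hb0.sub hz).ennreal_ofReal
      (hb0.sub hx).ennreal_ofReal hφ hC hCmono (hcase.mono fun ω h ↦ h.imp_right fun h ↦ by rw [h])
      fun N A hA hAC ↦ ?_
    obtain ⟨iz, ix, ia, ib, hae⟩ := hset N A hA hAC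
    rw [hrestr hAC, hrestr hAC, lintegral_ofReal_sub ib iz (hae.mono fun ω h ↦ h.2.2.2),
      lintegral_ofReal_sub ib ix (hae.mono fun ω h ↦ h.2.1), hopt N A hA hAC]

/-- The mean of `F` under the law of the exit point from `(a, b)` of a nonnegative continuous
martingale started at `x` and converging to `0`: if the upper barrier is active, the mean with
respect to the law on `{a, b}` with mean `x`, and the value at `a` otherwise. -/
noncomputable def exitMean (F : ℝ → ℝ≥0∞) (x a b : ℝ) : ℝ≥0∞ :=
  if 0 < b then
    ENNReal.ofReal (b - x) / ENNReal.ofReal (b - a) * F a +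
      ENNReal.ofReal (x - a) / ENNReal.ofReal (b - a) * F b
  else F a

/-- The law of geometric Brownian motion at an exit time, conditionally on the past of `τ`. -/
theorem lintegral_gbm_exitTime (hM : Martingale expBM ℋ sampleMeasure)
    (hτ : IsStoppingTime ℋ τ)
    (ham : Measurable[hτ.measurableSpace] a) (hbm : Measurable[hτ.measurableSpace] b)
    (hab : ∀ᵐ ω ∂sampleMeasure, 0 ≤ a ω ∧ a ω ≤ gbm (τ ω) ω ∧ (0 < b ω → gbm (τ ω) ω < b ω))
    {E : Type*} [MeasurableSpace E] {H : SampleSpace → E} (hH : Measurable[hτ.measurableSpace] H)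
    {F : E → ℝ → ℝ≥0∞} (hF : Measurable (Function.uncurry F)) :
    ∫⁻ ω, F (H ω) (gbm (exitTime expBM τ a b ω) ω) ∂sampleMeasure =
      ∫⁻ ω, exitMean (F (H ω)) (gbm (τ ω) ω) (a ω) (b ω) ∂sampleMeasure := by
  have hm := hτ.measurableSpace_le
  have hpos : MeasurableSet {ω | 0 < b ω} :=
    hm _ (measurableSet_lt measurable_const hbm)
  have hd : Measurable[hτ.measurableSpace] fun ω ↦ ENNReal.ofReal (b ω - a ω) :=
    (hbm.sub ham).ennreal_ofReal
  have hFa : Measurable[hτ.measurableSpace] fun ω ↦ F (H ω) (a ω) / ENNReal.ofReal (b ω - a ω) :=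
    (hF.comp (hH.prodMk ham)).div hd
  have hFb : Measurable[hτ.measurableSpace] fun ω ↦ F (H ω) (b ω) / ENNReal.ofReal (b ω - a ω) :=
    (hF.comp (hH.prodMk hbm)).div hd
  have hx : Measurable fun ω ↦ gbm (τ ω) ω := (measurable_gbm_stopped hM hτ).mono hm le_rfl
  have hσ : IsStoppingTime ℋ (exitTime expBM τ a b) :=
    isStoppingTime_exitTime continuous_expBM (fun t ↦ (hM.stronglyAdapted t).measurable) hτ ham hbm
  have hz : Measurable fun ω ↦ gbm (exitTime expBM τ a b ω) ω :=
    (measurable_gbm_stopped hM hσ).mono hσ.measurableSpace_le le_rfl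
  have ha0 : Measurable a := ham.mono hm le_rfl
  have hb0 : Measurable b := hbm.mono hm le_rfl
  rw [← lintegral_add_compl _ hpos, ← lintegral_add_compl (fun ω ↦ exitMean _ _ _ _) hpos]
  congr 1
  · have e1 : ∫⁻ ω in {ω | 0 < b ω}, F (H ω) (gbm (exitTime expBM τ a b ω) ω) ∂sampleMeasure =
        ∫⁻ ω in {ω | 0 < b ω},
          (F (H ω) (a ω) / ENNReal.ofReal (b ω - a ω) *
              ENNReal.ofReal (b ω - gbm (exitTime expBM τ a b ω) ω) +
            F (H ω) (b ω) / ENNReal.ofReal (b ω - a ω) *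
              ENNReal.ofReal (gbm (exitTime expBM τ a b ω) ω - a ω)) ∂sampleMeasure := by
      refine setLIntegral_congr_fun_ae hpos ?_
      filter_upwards [hab, ae_tendsto_expBM] with ω h hl hb
      have hlt : a ω < b ω := h.2.1.trans_lt (h.2.2 hb)
      have h0 : ENNReal.ofReal (b ω - a ω) ≠ 0 := by simpa using hlt
      rcases gbm_exitTime_mem hl h.1 h.2.1 h.2.2 with h' | ⟨-, h'⟩ <;> rw [h']
      · rw [sub_self, ENNReal.ofReal_zero, mul_zero, add_zero,
          ENNReal.div_mul_cancel h0 ENNReal.ofReal_ne_top]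
      · rw [sub_self, ENNReal.ofReal_zero, mul_zero, zero_add,
          ENNReal.div_mul_cancel h0 ENNReal.ofReal_ne_top]
    have m1 : Measurable fun ω ↦ F (H ω) (a ω) / ENNReal.ofReal (b ω - a ω) *
        ENNReal.ofReal (b ω - gbm (exitTime expBM τ a b ω) ω) :=
      (hFa.mono hm le_rfl).mul (hb0.sub hz).ennreal_ofReal
    have m2 : Measurable fun ω ↦ F (H ω) (a ω) / ENNReal.ofReal (b ω - a ω) *
        ENNReal.ofReal (b ω - gbm (τ ω) ω) :=
      (hFa.mono hm le_rfl).mul (hb0.sub hx).ennreal_ofReal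
    rw [e1, lintegral_add_left m1,
      (lintegral_mul_gbm_exitTime hM hτ ham hbm hab hFa).2,
      (lintegral_mul_gbm_exitTime hM hτ ham hbm hab hFb).1,
      ← lintegral_add_left m2]
    refine setLIntegral_congr_fun hpos fun ω hb ↦ ?_
    have hb' : 0 < b ω := hb
    simp only [exitMean, if_pos hb', div_eq_mul_inv]
    ring
  · refine setLIntegral_congr_fun_ae hpos.compl ?_
    filter_upwards [hab, ae_tendsto_expBM] with ω h hl hb
    have hb' : ¬ 0 < b ω := hb
    rcases gbm_exitTime_mem hl h.1 h.2.1 h.2.2 with h' | ⟨h', -⟩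
    · rw [h', exitMean, if_neg hb']
    · exact absurd h' hb'

end ExitLaw

/-! ### Splitting a distribution into two-point distributions -/

section Barriers

lemma measurable_exitMean {α : Type*} [MeasurableSpace α] {F : α → ℝ → ℝ≥0∞}
    (hF : Measurable (Function.uncurry F)) {x a b : α → ℝ} (hx : Measurable x) (ha : Measurable a)
    (hb : Measurable b) : Measurable fun t ↦ exitMean (F t) (x t) (a t) (b t) := by
  have hFa : Measurable fun t ↦ F t (a t) := hF.comp (measurable_id.prodMk ha)
  have hFb : Measurable fun t ↦ F t (b t) := hF.comp (measurable_id.prodMk hb)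
  unfold exitMean
  refine Measurable.ite (measurableSet_lt measurable_const hb) ?_ hFa
  exact (((hb.sub hx).ennreal_ofReal.div (hb.sub ha).ennreal_ofReal).mul hFa).add
    (((hx.sub ha).ennreal_ofReal.div (hb.sub ha).ennreal_ofReal).mul hFb)

/-- The mean of the overshoot of `x`. -/
noncomputable def meanAbove (ν : Measure ℝ) (x : ℝ) : ℝ≥0∞ := ∫⁻ y, ENNReal.ofReal (y - x) ∂ν

/-- The mean of the undershoot of `x`. -/
noncomputable def meanBelow (ν : Measure ℝ) (x : ℝ) : ℝ≥0∞ := ∫⁻ y, ENNReal.ofReal (x - y) ∂ν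

lemma meanBelow_ne_top {ν : Measure ℝ} [IsProbabilityMeasure ν] {x : ℝ}
    (hν : ∀ᵐ y ∂ν, 0 ≤ y) : meanBelow ν x ≠ ∞ := by
  refine ne_top_of_le_ne_top (ENNReal.ofReal_ne_top (r := x)) ?_
  calc meanBelow ν x ≤ ∫⁻ _, ENNReal.ofReal x ∂ν :=
        lintegral_mono_ae (hν.mono fun y hy ↦ ENNReal.ofReal_le_ofReal (by linarith))
    _ = ENNReal.ofReal x := by simp

lemma meanAbove_le_meanBelow {ν : Measure ℝ} [IsProbabilityMeasure ν] {x : ℝ} (hx : 0 ≤ x)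
    (hν : ∀ᵐ y ∂ν, 0 ≤ y) (hmean : ∫⁻ y, ENNReal.ofReal y ∂ν ≤ ENNReal.ofReal x) :
    meanAbove ν x ≤ meanBelow ν x := by
  have h : meanAbove ν x + ENNReal.ofReal x =
      (∫⁻ y, ENNReal.ofReal y ∂ν) + meanBelow ν x := by
    have hc : ENNReal.ofReal x = ∫⁻ _, ENNReal.ofReal x ∂ν := by simp
    rw [hc, meanAbove, meanBelow, ← lintegral_add_left (by fun_prop),
      ← lintegral_add_left (by fun_prop)]
    refine lintegral_congr_ae (hν.mono fun y hy ↦ ?_)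
    simp only
    rcases le_total x y with hxy | hxy
    · rw [ENNReal.ofReal_of_nonpos (sub_nonpos.2 hxy), add_zero,
        ← ENNReal.ofReal_add (sub_nonneg.2 hxy) hx, sub_add_cancel]
    · rw [ENNReal.ofReal_of_nonpos (sub_nonpos.2 hxy), zero_add,
        ← ENNReal.ofReal_add hy (sub_nonneg.2 hxy), add_sub_cancel]
  refine (ENNReal.add_le_add_iff_right (ENNReal.ofReal_ne_top (r := x))).1 ?_
  rw [h, add_comm]
  gcongr

/-- Density, with respect to `ν ⊗ ν`, of the law of the pair of barriers for the part of the mass in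
which both barriers are active. -/
noncomputable def pairDensity (ν : Measure ℝ) (x : ℝ) (p : ℝ × ℝ) : ℝ≥0∞ :=
  {p : ℝ × ℝ | p.1 ≤ x ∧ x < p.2}.indicator
    (fun p ↦ ENNReal.ofReal (p.2 - p.1) / meanBelow ν x) p

/-- Density, with respect to `ν`, of the law of the lower barrier for the part of the mass in which
the upper barrier is not active. If `meanBelow ν x = 0`, then the quotient is `0 / 0 = 0` and the
density is `1` on `(-∞, x]`, as it should be for the point mass at `x`. -/
noncomputable def singleDensity (ν : Measure ℝ) (x : ℝ) (y : ℝ) : ℝ≥0∞ :=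
  (Set.Iic x).indicator (fun _ ↦ 1 - meanAbove ν x / meanBelow ν x) y

/-- The exit point from a random pair of barriers has law `ν`. The pair of barriers around `x` with
density proportional to their distance carries the mass above `x` and a part of the mass below
`x`, and the single barriers carry what is left. -/
lemma lintegral_pairDensity_add {ν : Measure ℝ} [IsProbabilityMeasure ν] {x : ℝ} (hx : 0 ≤ x)
    (hν : ∀ᵐ y ∂ν, 0 ≤ y) (hmean : ∫⁻ y, ENNReal.ofReal y ∂ν ≤ ENNReal.ofReal x)
    {F : ℝ → ℝ≥0∞} (hF : Measurable F) :
    ∫⁻ p, pairDensity ν x p * exitMean F x p.1 p.2 ∂(ν.prod ν) +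
      ∫⁻ y, singleDensity ν x y * exitMean F x y 0 ∂ν = ∫⁻ y, F y ∂ν := by
  have hC := meanAbove_le_meanBelow hx hν hmean
  have hD : meanBelow ν x ≠ ∞ := meanBelow_ne_top hν
  have hfI : Measurable ((Set.Iic x).indicator F) := hF.indicator measurableSet_Iic
  have hgI : Measurable ((Set.Ioi x).indicator F) := hF.indicator measurableSet_Ioi
  have m1 : Measurable fun y : ℝ ↦ ENNReal.ofReal (y - x) / meanBelow ν x := by fun_prop
  have m2 : Measurable fun y : ℝ ↦ ENNReal.ofReal (x - y) / meanBelow ν x := by fun_prop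
  have e1 : ∫⁻ p, pairDensity ν x p * exitMean F x p.1 p.2 ∂(ν.prod ν) =
      (∫⁻ y in Set.Iic x, F y ∂ν) * (meanAbove ν x / meanBelow ν x) +
        (meanBelow ν x / meanBelow ν x) * ∫⁻ y in Set.Ioi x, F y ∂ν := by
    have : ∀ p : ℝ × ℝ, pairDensity ν x p * exitMean F x p.1 p.2 =
        (Set.Iic x).indicator F p.1 * (ENNReal.ofReal (p.2 - x) / meanBelow ν x) +
          (ENNReal.ofReal (x - p.1) / meanBelow ν x) * (Set.Ioi x).indicator F p.2 := by
      intro p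
      by_cases h1 : p.1 ≤ x
      · by_cases h2 : x < p.2
        · have hlt : p.1 < p.2 := h1.trans_lt h2
          have hne : ENNReal.ofReal (p.2 - p.1) ≠ 0 := by simpa using hlt
          rw [pairDensity, Set.indicator_of_mem (by exact ⟨h1, h2⟩), exitMean,
            if_pos (hx.trans_lt h2),
            Set.indicator_of_mem (by exact h1), Set.indicator_of_mem (by exact h2)]
          have hcancel := ENNReal.mul_inv_cancel hne ENNReal.ofReal_ne_top
          simp only [div_eq_mul_inv]
          calc _ = (ENNReal.ofReal (p.2 - p.1) * (ENNReal.ofReal (p.2 - p.1))⁻¹) *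
                (F p.1 * (ENNReal.ofReal (p.2 - x) * (meanBelow ν x)⁻¹) +
                  ENNReal.ofReal (x - p.1) * (meanBelow ν x)⁻¹ * F p.2) := by ring
            _ = _ := by rw [hcancel, one_mul]
        · rw [pairDensity, Set.indicator_of_notMem (fun h ↦ h2 h.2),
            Set.indicator_of_notMem (s := Set.Ioi x) (by exact h2),
            ENNReal.ofReal_of_nonpos (sub_nonpos.2 (not_lt.1 h2))]
          simp
      · rw [pairDensity, Set.indicator_of_notMem (fun h ↦ h1 h.1),
          Set.indicator_of_notMem (s := Set.Iic x) (by exact h1),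
          ENNReal.ofReal_of_nonpos (sub_nonpos.2 (not_le.1 h1).le)]
        simp
    simp_rw [this]
    rw [lintegral_add_left (by fun_prop), lintegral_prod_mul hfI.aemeasurable m1.aemeasurable,
      lintegral_prod_mul m2.aemeasurable hgI.aemeasurable, lintegral_indicator measurableSet_Iic,
      lintegral_indicator measurableSet_Ioi]
    simp only [div_eq_mul_inv]
    rw [lintegral_mul_const _ (by fun_prop), lintegral_mul_const _ (by fun_prop)]
    rfl
  have e2 : ∫⁻ y, singleDensity ν x y * exitMean F x y 0 ∂ν =
      (1 - meanAbove ν x / meanBelow ν x) * ∫⁻ y in Set.Iic x, F y ∂ν := by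
    rw [← lintegral_const_mul _ hF, ← lintegral_indicator measurableSet_Iic]
    refine lintegral_congr fun y ↦ ?_
    rw [singleDensity, exitMean, if_neg (lt_irrefl 0)]
    by_cases h : y ∈ Set.Iic x
    · rw [Set.indicator_of_mem h, Set.indicator_of_mem h]
    · rw [Set.indicator_of_notMem h, Set.indicator_of_notMem h, zero_mul]
  have hq : meanAbove ν x / meanBelow ν x ≤ 1 := ENNReal.div_le_of_le_mul (by rwa [one_mul])
  have e3 : (meanBelow ν x / meanBelow ν x) * ∫⁻ y in Set.Ioi x, F y ∂ν =
      ∫⁻ y in Set.Ioi x, F y ∂ν := by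
    by_cases h0 : meanBelow ν x = 0
    · -- then `ν` is concentrated on `{x}`
      have hz : meanAbove ν x = 0 := le_antisymm (h0 ▸ hC) bot_le
      rw [meanAbove, lintegral_eq_zero_iff (by fun_prop)] at hz
      have hnull : ν (Set.Ioi x) = 0 := by
        refine measure_mono_null (t := {y | ¬ ENNReal.ofReal (y - x) = 0}) ?_ hz
        intro y hy
        simpa using hy
      rw [Measure.restrict_eq_zero.2 hnull]
      simp
    · rw [ENNReal.div_self h0 hD, one_mul]
  rw [e1, e2, e3, add_right_comm, mul_comm (∫⁻ y in Set.Iic x, F y ∂ν), ← add_mul,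
    add_tsub_cancel_of_le hq, one_mul]
  have := lintegral_add_compl (μ := ν) F (measurableSet_Iic (a := x))
  rwa [Set.compl_Iic] at this

/-- A kernel on `[0, ∞)` with means at most `x` is the law of the exit point of a fair game started
at `x` from a randomized pair of barriers. A second coordinate `0` stands for the absence of an
upper barrier, since an actual upper barrier exceeds `x` and is positive. -/
theorem exists_barriers {E : Type*} [MeasurableSpace E] (κ : Kernel E ℝ) [IsMarkovKernel κ]
    {x : E → ℝ} (hxm : Measurable x) (hx : ∀ h, 0 ≤ x h) (hκ : ∀ h, ∀ᵐ y ∂κ h, 0 ≤ y)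
    (hmean : ∀ h, ∫⁻ y, ENNReal.ofReal y ∂κ h ≤ ENNReal.ofReal (x h)) :
    ∃ ρ : E → unitInterval → ℝ × ℝ, Measurable (Function.uncurry ρ) ∧
      (∀ h, ∀ᵐ r, 0 ≤ (ρ h r).1 ∧ (ρ h r).1 ≤ x h ∧ (0 < (ρ h r).2 → x h < (ρ h r).2)) ∧
      ∀ h, ∀ F : ℝ → ℝ≥0∞, Measurable F →
        ∫⁻ r, exitMean F (x h) (ρ h r).1 (ρ h r).2 = ∫⁻ y, F y ∂κ h := by
  have hA : Measurable fun h ↦ meanAbove (κ h) (x h) :=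
    Measurable.lintegral_kernel_prod_right (f := fun h y ↦ ENNReal.ofReal (y - x h)) (by fun_prop)
  have hB : Measurable fun h ↦ meanBelow (κ h) (x h) :=
    Measurable.lintegral_kernel_prod_right (f := fun h y ↦ ENNReal.ofReal (x h - y)) (by fun_prop)
  have hp : Measurable (Function.uncurry fun h ↦ pairDensity (κ h) (x h)) := by
    refine Measurable.indicator (f := fun q : E × ℝ × ℝ ↦
      ENNReal.ofReal (q.2.2 - q.2.1) / meanBelow (κ q.1) (x q.1))
      (s := {q : E × ℝ × ℝ | q.2.1 ≤ x q.1 ∧ x q.1 < q.2.2}) ?_ ?_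
    · exact Measurable.div (by fun_prop) (hB.comp measurable_fst)
    · have h1 : MeasurableSet {q : E × ℝ × ℝ | q.2.1 ≤ x q.1} :=
        measurableSet_le (by fun_prop) (by fun_prop)
      have h2 : MeasurableSet {q : E × ℝ × ℝ | x q.1 < q.2.2} :=
        measurableSet_lt (by fun_prop) (by fun_prop)
      exact h1.inter h2
  have hs : Measurable (Function.uncurry fun h ↦ singleDensity (κ h) (x h)) := by
    refine Measurable.indicator (f := fun q : E × ℝ ↦
      1 - meanAbove (κ q.1) (x q.1) / meanBelow (κ q.1) (x q.1))
      (s := {q : E × ℝ | q.2 ≤ x q.1}) ?_ ?_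
    · exact measurable_const.sub ((hA.comp measurable_fst).div (hB.comp measurable_fst))
    · exact measurableSet_le (by fun_prop) (by fun_prop)
  set π : Kernel E (ℝ × ℝ) := (κ ×ₖ κ).withDensity (fun h ↦ pairDensity (κ h) (x h)) +
    (κ.withDensity fun h ↦ singleDensity (κ h) (x h)).map (fun y ↦ (y, (0 : ℝ))) with hπ
  have hmk : Measurable fun y : ℝ ↦ (y, (0 : ℝ)) := by fun_prop
  have hπint (h : E) {G : ℝ × ℝ → ℝ≥0∞} (hG : Measurable G) : ∫⁻ p, G p ∂π h =
      ∫⁻ p, pairDensity (κ h) (x h) p * G p ∂((κ h).prod (κ h)) +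
        ∫⁻ y, singleDensity (κ h) (x h) y * G (y, 0) ∂κ h := by
    rw [hπ, add_apply, lintegral_add_measure, Kernel.lintegral_withDensity _ hp _ hG,
      Kernel.prod_apply, Kernel.lintegral_map _ hmk _ hG,
      Kernel.lintegral_withDensity _ hs _ (g := fun y ↦ G (y, 0)) (hG.comp hmk)]
  have hπF (h : E) {F : ℝ → ℝ≥0∞} (hF : Measurable F) :
      ∫⁻ p, exitMean F (x h) p.1 p.2 ∂π h = ∫⁻ y, F y ∂κ h := by
    rw [hπint h (measurable_exitMean (F := fun _ ↦ F) (by fun_prop) measurable_const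
      measurable_fst measurable_snd)]
    exact lintegral_pairDensity_add (hx h) (hκ h) (hmean h) hF
  have hsupp (h : E) : ∀ᵐ p ∂π h, 0 ≤ p.1 ∧ p.1 ≤ x h ∧ (0 < p.2 → x h < p.2) := by
    have hmeas : MeasurableSet {p : ℝ × ℝ | 0 ≤ p.1 ∧ p.1 ≤ x h ∧ (0 < p.2 → x h < p.2)} := by
      measurability
    have hp' : Measurable (pairDensity (κ h) (x h)) :=
      hp.comp (by fun_prop : Measurable fun p : ℝ × ℝ ↦ (h, p))
    have hs' : Measurable (singleDensity (κ h) (x h)) :=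
      hs.comp (by fun_prop : Measurable fun p : ℝ ↦ (h, p))
    rw [hπ, add_apply, ae_add_measure_iff, Kernel.withDensity_apply _ hp, Kernel.prod_apply,
      Kernel.map_apply _ hmk, Kernel.withDensity_apply _ hs,
      ae_withDensity_iff hp', ae_map_iff hmk.aemeasurable hmeas, ae_withDensity_iff hs']
    constructor
    · have h0 : ∀ᵐ p ∂((κ h).prod (κ h)), 0 ≤ p.1 :=
        Measure.quasiMeasurePreserving_fst.ae (hκ h)
      filter_upwards [h0] with p hp0 hne
      have hmem := Set.mem_of_indicator_ne_zero hne
      exact ⟨hp0, hmem.1, fun _ ↦ hmem.2⟩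
    · filter_upwards [hκ h] with y hy hne
      exact ⟨hy, Set.mem_of_indicator_ne_zero (s := Set.Iic (x h)) hne,
        fun h0 ↦ absurd h0 (lt_irrefl 0)⟩
  have hmarkov : IsMarkovKernel π := by
    refine ⟨fun h ↦ ⟨?_⟩⟩
    have h1 := hπF h (F := fun _ ↦ 1) measurable_const
    rw [lintegral_one, measure_univ] at h1
    rw [← lintegral_one]
    refine Eq.trans ?_ h1
    refine lintegral_congr_ae ((hsupp h).mono fun p hp ↦ ?_)
    simp only [exitMean, mul_one]
    split_ifs with hb
    · have hlt := hp.2.2 hb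
      have hne : ENNReal.ofReal (p.2 - p.1) ≠ 0 := by simpa using hp.2.1.trans_lt hlt
      rw [ENNReal.div_add_div_same, ← ENNReal.ofReal_add (by linarith) (by linarith [hp.2.1]),
        sub_add_sub_cancel, ENNReal.div_self hne ENNReal.ofReal_ne_top]
    · rfl
  obtain ⟨ρ, hρm, hρ⟩ := Kernel.exists_measurable_map_eq_unitInterval π
  have hρm' (h : E) : Measurable (ρ h) := hρm.comp measurable_prodMk_left
  refine ⟨ρ, hρm, fun h ↦ ?_, fun h F hF ↦ ?_⟩
  · have := hsupp h
    rw [← hρ h] at this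
    exact ae_of_ae_map (hρm' h).aemeasurable this
  · rw [← hπF h hF, ← hρ h, lintegral_map _ (hρm' h)]
    exact measurable_exitMean (F := fun _ ↦ F) (by fun_prop) measurable_const
      measurable_fst measurable_snd

end Barriers

/-! ### Filtrations with unused randomization -/

section Stages

/-- The σ-algebra generated by the whole path and by the first `n` uniform variables. -/
abbrev stageSigma (n : ℕ) : MeasurableSpace SampleSpace :=
  MeasurableSpace.comap (fun ω ↦ (fun k : Finset.range n ↦ coordR k ω, ω.1)) inferInstance

lemma measurable_stageSigma_coordB (n : ℕ) (t : ℝ≥0) : Measurable[stageSigma n] (coordB t) :=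
  ((continuous_eval_const (F := C(ℝ≥0, ℝ)) t).measurable.comp measurable_snd).comp
    (comap_measurable _)

lemma measurable_stageSigma_coordR {n k : ℕ} (h : k < n) : Measurable[stageSigma n] (coordR k) :=
  ((measurable_pi_apply (⟨k, Finset.mem_range.2 h⟩ : Finset.range n)).comp measurable_fst).comp
    (comap_measurable fun ω : SampleSpace ↦ (fun k : Finset.range n ↦ coordR k ω, ω.1))

lemma stageSigma_mono : Monotone stageSigma := by
  refine monotone_nat_of_le_succ fun n ↦ ?_
  have h1 : Measurable[stageSigma (n + 1)] fun (ω : SampleSpace) (k : Finset.range n) ↦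
      coordR k ω := by
    rw [@measurable_pi_iff]
    exact fun k ↦ measurable_stageSigma_coordR ((Finset.mem_range.1 k.2).trans n.lt_succ_self)
  have h2 : Measurable[stageSigma (n + 1)] fun ω : SampleSpace ↦ ω.1 :=
    measurable_snd.comp (comap_measurable _)
  exact (h1.prodMk h2).comap_le

lemma indepFun_snd_of_prod {α β γ δ : Type*} {mα : MeasurableSpace α}
    {mβ : MeasurableSpace β} {mγ : MeasurableSpace γ} {mδ : MeasurableSpace δ} {μ : Measure α}
    {ρ : Measure β} [IsProbabilityMeasure μ] [IsProbabilityMeasure ρ] {U : β → γ} {V : β → δ}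
    (hU : Measurable U) (hV : Measurable V) (h : IndepFun U V ρ) :
    IndepFun (fun p : α × β ↦ U p.2) (fun p : α × β ↦ (V p.2, p.1)) (μ.prod ρ) := by
  have h1 := indepFun_prodMk_right_of_prod (ρ := μ) hU hV h
  rw [indepFun_iff_map_prod_eq_prod_map_map (by fun_prop) (by fun_prop)] at h1 ⊢
  rw [← Measure.prod_swap, Measure.map_map (by fun_prop) (by fun_prop),
    Measure.map_map (by fun_prop) (by fun_prop), Measure.map_map (by fun_prop) (by fun_prop)]
  exact h1

lemma indep_coordR_stageSigma (n : ℕ) :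
    Indep (stageSigma n) (MeasurableSpace.comap (coordR n) inferInstance) sampleMeasure := by
  have h0 : iIndepFun (fun (k : ℕ) (r : ℕ → unitInterval) ↦ r k)
      (Measure.infinitePi fun _ : ℕ ↦ (volume : Measure unitInterval)) :=
    iIndepFun_infinitePi (X := fun _ ↦ id) fun _ ↦ measurable_id
  have h1 := h0.indepFun_finset {n} (Finset.range n) (by simp) fun k ↦ measurable_pi_apply k
  have h2 := h1.comp (measurable_pi_apply (⟨n, Finset.mem_singleton_self n⟩ : ({n} : Finset ℕ)))
    measurable_id
  have h3 := indepFun_snd_of_prod (μ := wienerMeasure) (measurable_pi_apply n)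
    (measurable_pi_lambda _ fun k : Finset.range n ↦ measurable_pi_apply k.1) h2
  exact Indep.symm h3

/-- The part of the filtration that does not use the uniform variables from the `n`-th on. -/
def stageFiltration (n : ℕ) : Filtration ℝ≥0 (inferInstance : MeasurableSpace SampleSpace) where
  seq t := sampleFiltration t ⊓ stageSigma n
  mono' _ _ h := inf_le_inf_right _ (sampleFiltration.mono h)
  le' t := inf_le_left.trans (sampleFiltration.le t)

lemma measurable_stageFiltration_iff {n : ℕ} {t : ℝ≥0} {β : Type*} [MeasurableSpace β]
    {f : SampleSpace → β} : Measurable[stageFiltration n t] f ↔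
      Measurable[sampleFiltration t] f ∧ Measurable[stageSigma n] f :=
  ⟨fun h ↦ ⟨fun _ hs ↦ (h hs).1, fun _ hs ↦ (h hs).2⟩, fun h _ hs ↦ ⟨h.1 hs, h.2 hs⟩⟩

lemma stageFiltration_mono {n m : ℕ} (h : n ≤ m) : stageFiltration n ≤ stageFiltration m :=
  fun _ ↦ inf_le_inf_left _ (stageSigma_mono h)

lemma stageFiltration_le (n : ℕ) : stageFiltration n ≤ sampleFiltration := fun _ ↦ inf_le_left

lemma martingale_expBM_stageFiltration (n : ℕ) :
    Martingale expBM (stageFiltration n) sampleMeasure := by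
  have hmeas (t : ℝ≥0) : Measurable[stageFiltration n t] (expBM t) :=
    measurable_stageFiltration_iff.2 ⟨measurable_expBM_of_le le_rfl,
      Real.measurable_exp.comp ((measurable_stageSigma_coordB n t).sub_const _)⟩
  refine ⟨fun t ↦ (hmeas t).stronglyMeasurable, fun s t hst ↦ ?_⟩
  have h1 := condExp_condExp_of_le (f := expBM t) (μ := sampleMeasure)
    (stageFiltration_le n s) (sampleFiltration.le s)
  have h2 := condExp_congr_ae (m := stageFiltration n s) (martingale_expBM.condExp_ae_eq hst)
  refine h1.symm.trans (h2.trans ?_)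
  rw [condExp_of_stronglyMeasurable ((stageFiltration n).le s) (hmeas s).stronglyMeasurable
    (integrable_expBM s)]

lemma isStoppingTime_mono {Ω : Type*} {mΩ : MeasurableSpace Ω} {ℱ 𝒢 : Filtration ℝ≥0 mΩ}
    (h : ℱ ≤ 𝒢) {τ : Ω → WithTop ℝ≥0} (hτ : IsStoppingTime ℱ τ) : IsStoppingTime 𝒢 τ :=
  fun t ↦ h t _ (hτ t)

lemma stoppingMeasurableSpace_mono {Ω : Type*} {mΩ : MeasurableSpace Ω} {ℱ 𝒢 : Filtration ℝ≥0 mΩ}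
    (h : ℱ ≤ 𝒢) {τ : Ω → WithTop ℝ≥0} (hτ : IsStoppingTime ℱ τ) :
    hτ.measurableSpace ≤ (isStoppingTime_mono h hτ).measurableSpace :=
  fun A hA ↦ ⟨iSup_mono (fun t ↦ h t) A hA.1, fun t ↦ h t _ (hA.2 t)⟩

/-- One step of the embedding. If `gbm` stopped at `τ` is a function `x` of a history `H`, and `κ`
is a kernel with means at most `x`, then the next uniform variable is used to choose barriers at
which `gbm` is stopped with conditional law `κ` given `H`. -/
theorem exists_stoppingTime_of_kernel {n : ℕ} {τ : SampleSpace → WithTop ℝ≥0}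
    (hτ : IsStoppingTime (stageFiltration n) τ) {E : Type*} [MeasurableSpace E]
    {H : SampleSpace → E} (hH : Measurable[hτ.measurableSpace] H) (κ : Kernel E ℝ)
    [IsMarkovKernel κ] {x : E → ℝ} (hxm : Measurable x) (hx : ∀ h, 0 ≤ x h)
    (hκ : ∀ h, ∀ᵐ y ∂κ h, 0 ≤ y)
    (hmean : ∀ h, ∫⁻ y, ENNReal.ofReal y ∂κ h ≤ ENNReal.ofReal (x h))
    (hτx : ∀ᵐ ω ∂sampleMeasure, gbm (τ ω) ω = x (H ω)) :
    ∃ σ : SampleSpace → WithTop ℝ≥0, ∃ hσ : IsStoppingTime (stageFiltration (n + 1)) σ,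
      τ ≤ σ ∧ Measurable[hσ.measurableSpace] H ∧
      Measurable[hσ.measurableSpace] (fun ω ↦ gbm (σ ω) ω) ∧
      sampleMeasure.map (fun ω ↦ (H ω, gbm (σ ω) ω)) = (sampleMeasure.map H) ⊗ₘ κ := by
  obtain ⟨ρ, hρm, hρ, hρint⟩ := exists_barriers κ hxm hx hκ hmean
  have hle := stageFiltration_mono n.le_succ
  have hτ' := isStoppingTime_mono hle hτ
  have hM := martingale_expBM_stageFiltration (n + 1)
  have hH' : Measurable[hτ'.measurableSpace] H :=
    hH.mono (stoppingMeasurableSpace_mono hle hτ) le_rfl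
  have hH0 : Measurable H := hH.mono hτ.measurableSpace_le le_rfl
  have hR : Measurable[hτ'.measurableSpace] (coordR n) := by
    have h1 : Measurable[stageFiltration (n + 1) 0] (coordR n) :=
      measurable_stageFiltration_iff.2 ⟨measurable_coordR_zero n 0,
        measurable_stageSigma_coordR n.lt_succ_self⟩
    exact h1.mono (hτ'.le_measurableSpace_of_const_le fun ω ↦ bot_le) le_rfl
  have hHR : Measurable[hτ'.measurableSpace] fun ω ↦ ρ (H ω) (coordR n ω) :=
    hρm.comp (hH'.prodMk hR)
  -- the history only depends on the path and on the uniform variables before the `n`-th one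
  have hind : IndepFun H (coordR n) sampleMeasure := by
    refine indep_of_indep_of_le_left (indep_coordR_stageSigma n) ?_
    rw [← measurable_iff_comap_le]
    refine hH.mono (hτ.measurableSpace_le'.trans (iSup_le fun t ↦ inf_le_right)) le_rfl
  have := Measure.isProbabilityMeasure_map (μ := sampleMeasure) hH0.aemeasurable
  have hlaw : sampleMeasure.map (fun ω ↦ (H ω, coordR n ω)) =
      (sampleMeasure.map H).prod volume := by
    rw [(indepFun_iff_map_prod_eq_prod_map_map hH0.aemeasurable
      (measurable_coordR n).aemeasurable).1 hind, (hasLaw_coordR n).map_eq]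
  have hpm : Measurable fun ω ↦ (H ω, coordR n ω) := hH0.prodMk (measurable_coordR n)
  have hab : ∀ᵐ ω ∂sampleMeasure, 0 ≤ (ρ (H ω) (coordR n ω)).1 ∧
      (ρ (H ω) (coordR n ω)).1 ≤ gbm (τ ω) ω ∧
      (0 < (ρ (H ω) (coordR n ω)).2 → gbm (τ ω) ω < (ρ (H ω) (coordR n ω)).2) := by
    have hprod : ∀ᵐ p ∂(sampleMeasure.map H).prod volume, 0 ≤ (ρ p.1 p.2).1 ∧
        (ρ p.1 p.2).1 ≤ x p.1 ∧ (0 < (ρ p.1 p.2).2 → x p.1 < (ρ p.1 p.2).2) := by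
      refine (Measure.ae_prod_iff_ae_ae ?_).2 (Eventually.of_forall hρ)
      have m1 : Measurable fun p : E × unitInterval ↦ (ρ p.1 p.2).1 := measurable_fst.comp hρm
      have m2 : Measurable fun p : E × unitInterval ↦ (ρ p.1 p.2).2 := measurable_snd.comp hρm
      have m3 : Measurable fun p : E × unitInterval ↦ x p.1 := hxm.comp measurable_fst
      exact (measurableSet_le measurable_const m1).inter ((measurableSet_le m1 m3).inter
        (MeasurableSet.imp (measurableSet_lt measurable_const m2) (measurableSet_lt m3 m2)))
    rw [← hlaw] at hprod
    filter_upwards [ae_of_ae_map hpm.aemeasurable hprod, hτx] with ω h1 h2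
    rw [h2]; exact h1
  have ham := measurable_fst.comp hHR
  have hbm := measurable_snd.comp hHR
  set σ := exitTime expBM τ (Prod.fst ∘ fun ω ↦ ρ (H ω) (coordR n ω))
    (Prod.snd ∘ fun ω ↦ ρ (H ω) (coordR n ω))
  have hσ : IsStoppingTime (stageFiltration (n + 1)) σ :=
    isStoppingTime_exitTime continuous_expBM (fun t ↦ (hM.stronglyAdapted t).measurable) hτ' ham hbm
  have hτσ : τ ≤ σ := fun ω ↦ le_exitTime (continuous_expBM ω)
  have hgσ := measurable_gbm_stopped hM hσ
  refine ⟨σ, hσ, hτσ, hH'.mono (hτ'.measurableSpace_mono hσ hτσ) le_rfl, hgσ, ?_⟩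
  have hpair : Measurable fun ω ↦ (H ω, gbm (σ ω) ω) :=
    hH0.prodMk (hgσ.mono hσ.measurableSpace_le le_rfl)
  refine Measure.ext fun s hs ↦ ?_
  have hF : Measurable (s.indicator (1 : E × ℝ → ℝ≥0∞)) := measurable_one.indicator hs
  rw [← lintegral_indicator_one hs, ← lintegral_indicator_one hs, lintegral_map hF hpair,
    Measure.lintegral_compProd hF]
  set F : E → ℝ → ℝ≥0∞ := fun h y ↦ s.indicator 1 (h, y)
  have hFm : Measurable (Function.uncurry F) := hF
  have hG : Measurable fun p : E × unitInterval ↦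
      exitMean (F p.1) (x p.1) (ρ p.1 p.2).1 (ρ p.1 p.2).2 :=
    measurable_exitMean (F := fun p : E × unitInterval ↦ F p.1)
      (hFm.comp ((measurable_fst.comp measurable_fst).prodMk measurable_snd))
      (hxm.comp measurable_fst) (measurable_fst.comp hρm) (measurable_snd.comp hρm)
  calc ∫⁻ ω, F (H ω) (gbm (σ ω) ω) ∂sampleMeasure
      = ∫⁻ ω, exitMean (F (H ω)) (gbm (τ ω) ω) (ρ (H ω) (coordR n ω)).1
          (ρ (H ω) (coordR n ω)).2 ∂sampleMeasure :=
        lintegral_gbm_exitTime hM hτ' ham hbm hab hH' hFm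
    _ = ∫⁻ ω, exitMean (F (H ω)) (x (H ω)) (ρ (H ω) (coordR n ω)).1
          (ρ (H ω) (coordR n ω)).2 ∂sampleMeasure :=
        lintegral_congr_ae (hτx.mono fun ω h ↦ by simp only [h])
    _ = ∫⁻ p, exitMean (F p.1) (x p.1) (ρ p.1 p.2).1 (ρ p.1 p.2).2
          ∂(sampleMeasure.map fun ω ↦ (H ω, coordR n ω)) := (lintegral_map hG hpm).symm
    _ = ∫⁻ h, (∫⁻ r, exitMean (F h) (x h) (ρ h r).1 (ρ h r).2) ∂(sampleMeasure.map H) := by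
        rw [hlaw, lintegral_prod _ hG.aemeasurable]
    _ = ∫⁻ h, ∫⁻ y, F h y ∂κ h ∂(sampleMeasure.map H) :=
        lintegral_congr fun h ↦ hρint h (F h) (hFm.comp measurable_prodMk_left)

end Stages

/-! ### Embedding a supermartingale -/

section Embedding

/-- The first terms, up to the index `n`, of a sequence, followed by zeros. -/
def truncSeq (n : ℕ) (z : ℕ → ℝ) (k : ℕ) : ℝ := if k ≤ n then z k else 0

lemma measurable_truncSeq (n : ℕ) : Measurable (truncSeq n) := by
  refine measurable_pi_lambda _ fun k ↦ ?_
  unfold truncSeq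
  split_ifs <;> fun_prop

lemma update_truncSeq (n : ℕ) (z : ℕ → ℝ) :
    Function.update (truncSeq n z) (n + 1) (z (n + 1)) = truncSeq (n + 1) z := by
  ext k
  rcases eq_or_ne k (n + 1) with rfl | hk
  · simp [truncSeq]
  · have : k ≤ n + 1 ↔ k ≤ n := by omega
    simp [Function.update_of_ne hk, truncSeq, this]

lemma measure_eq_of_map_truncSeq_eq {μ ν : Measure (ℕ → ℝ)} [IsProbabilityMeasure μ]
    [IsProbabilityMeasure ν] (h : ∀ n, μ.map (truncSeq n) = ν.map (truncSeq n)) : μ = ν := by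
  refine IsProjectiveLimit.unique (P := fun I : Finset ℕ ↦ μ.map I.restrict)
    (fun I ↦ rfl) fun I ↦ ?_
  have hI : I.restrict (π := fun _ ↦ ℝ) = I.restrict ∘ truncSeq (I.sup id) := by
    ext z k
    have hk : (k : ℕ) ≤ I.sup id := Finset.le_sup (f := id) k.2
    simp [truncSeq, hk]
  show ν.map I.restrict = μ.map I.restrict
  rw [hI, ← Measure.map_map (by fun_prop) (measurable_truncSeq _), ← h,
    Measure.map_map (by fun_prop) (measurable_truncSeq _)]

/-- If the conditional mean of `V ≥ 0` given `U` is at most `x U`, then there is a version of the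
conditional law with support in `[0, ∞)` and means at most `x` everywhere. -/
lemma exists_condDistrib_mean_le {Ω' E : Type*} {m' : MeasurableSpace Ω'} [MeasurableSpace E]
    {Pr : Measure Ω'} [IsProbabilityMeasure Pr] {U : Ω' → E} {V : Ω' → ℝ} {x : E → ℝ}
    (hU : Measurable U) (hV : Measurable V) (hxm : Measurable x) (hx : ∀ h, 0 ≤ x h)
    (hV0 : ∀ᵐ ω ∂Pr, 0 ≤ V ω)
    (hle : ∀ A, MeasurableSet A → ∫⁻ ω in U ⁻¹' A, ENNReal.ofReal (V ω) ∂Pr ≤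
      ∫⁻ ω in U ⁻¹' A, ENNReal.ofReal (x (U ω)) ∂Pr) :
    ∃ κ : Kernel E ℝ, IsMarkovKernel κ ∧ (∀ h, ∀ᵐ y ∂κ h, 0 ≤ y) ∧
      (∀ h, ∫⁻ y, ENNReal.ofReal y ∂κ h ≤ ENNReal.ofReal (x h)) ∧
      (Pr.map U) ⊗ₘ κ = Pr.map fun ω ↦ (U ω, V ω) := by
  have := Measure.isProbabilityMeasure_map (μ := Pr) hU.aemeasurable
  set κ₀ := condDistrib V U Pr
  have hlaw : (Pr.map U) ⊗ₘ κ₀ = Pr.map fun ω ↦ (U ω, V ω) :=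
    compProd_map_condDistrib hV.aemeasurable
  set m : E → ℝ≥0∞ := fun h ↦ ∫⁻ y, ENNReal.ofReal y ∂κ₀ h with hm_def
  have hm : Measurable m :=
    Measurable.lintegral_kernel_prod_right (f := fun _ y ↦ ENNReal.ofReal y) (by fun_prop)
  have hS : MeasurableSet ({h | κ₀ h (Set.Iio 0) = 0} ∩ {h | m h ≤ ENNReal.ofReal (x h)}) :=
    (measurableSet_eq_fun (κ₀.measurable_coe measurableSet_Iio) measurable_const).inter
      (measurableSet_le hm hxm.ennreal_ofReal)
  have hae1 : ∀ᵐ h ∂(Pr.map U), κ₀ h (Set.Iio 0) = 0 := by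
    have h1 : ∀ᵐ p ∂(Pr.map U) ⊗ₘ κ₀, 0 ≤ p.2 := by
      rw [hlaw, ae_map_iff (hU.prodMk hV).aemeasurable
        (measurableSet_le (by fun_prop) (by fun_prop))]
      exact hV0
    filter_upwards [Measure.ae_ae_of_ae_compProd h1] with h hh
    refine measure_mono_null (fun y (hy : y < 0) ↦ ?_) hh
    exact not_le.2 hy
  have hae2 : m ≤ᵐ[Pr.map U] fun h ↦ ENNReal.ofReal (x h) := by
    refine ae_le_of_forall_setLIntegral_le_of_sigmaFinite hm fun A hA _ ↦ ?_
    have h1 := Measure.setLIntegral_compProd (μ := Pr.map U) (κ := κ₀)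
      (f := fun p ↦ ENNReal.ofReal p.2) (by fun_prop) hA MeasurableSet.univ
    rw [hlaw, setLIntegral_map (hA.prod MeasurableSet.univ) (by fun_prop) (hU.prodMk hV)] at h1
    simp only [Measure.restrict_univ] at h1
    rw [hm_def, ← h1, setLIntegral_map hA (by fun_prop) hU]
    refine le_trans (le_of_eq ?_) (hle A hA)
    congr 2
    ext ω
    simp
  classical
  -- on the exceptional null set, replace the conditional law by a point mass
  refine ⟨Kernel.piecewise hS κ₀ (Kernel.deterministic x hxm), inferInstance, fun h ↦ ?_,
    fun h ↦ ?_, ?_⟩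
  · rw [Kernel.piecewise_apply]
    split_ifs with hh
    · rw [ae_iff]
      have h0 : κ₀ h (Set.Iio 0) = 0 := hh.1
      simp only [not_le]
      exact h0
    · rw [Kernel.deterministic_apply, ae_dirac_iff measurableSet_Ici]
      exact hx h
  · rw [Kernel.piecewise_apply]
    split_ifs with hh
    · exact hh.2
    · rw [Kernel.deterministic_apply, lintegral_dirac' _ (by fun_prop)]
  · rw [← hlaw]
    refine Measure.compProd_congr ?_
    filter_upwards [hae1, hae2] with h h1 h2
    rw [Kernel.piecewise_apply, if_pos ⟨h1, h2⟩]

variable {Ω' : Type*} {m' : MeasurableSpace Ω'} {Pr : Measure Ω'} [IsProbabilityMeasure Pr]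
  {𝓖 : Filtration ℕ m'} {X : ℕ → Ω' → ℝ}

lemma exists_kernel_supermartingale (hX : Supermartingale X 𝓖 Pr)
    (hX_nonneg : ∀ n, ∀ᵐ ω ∂Pr, 0 ≤ X n ω) (n : ℕ) :
    ∃ κ : Kernel (ℕ → ℝ) ℝ, IsMarkovKernel κ ∧ (∀ h, ∀ᵐ y ∂κ h, 0 ≤ y) ∧
      (∀ h, ∫⁻ y, ENNReal.ofReal y ∂κ h ≤ ENNReal.ofReal (max (h n) 0)) ∧
      (Pr.map fun ω ↦ truncSeq n fun k ↦ X k ω) ⊗ₘ κ =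
        Pr.map fun ω ↦ (truncSeq n fun k ↦ X k ω, X (n + 1) ω) := by
  have hXm (k : ℕ) : Measurable[𝓖 k] (X k) := (hX.stronglyAdapted k).measurable
  have hU : Measurable[𝓖 n] fun ω ↦ truncSeq n fun k ↦ X k ω := by
    rw [@measurable_pi_iff]
    intro k
    unfold truncSeq
    split_ifs with hk
    · exact (hXm k).mono (𝓖.mono hk) le_rfl
    · exact measurable_const
  refine exists_condDistrib_mean_le (x := fun h ↦ max (h n) 0) (hU.mono (𝓖.le n) le_rfl)
    ((hXm (n + 1)).mono (𝓖.le _) le_rfl) (by fun_prop) (fun h ↦ le_max_right _ _)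
    (hX_nonneg (n + 1)) fun A hA ↦ ?_
  have h1 := hX.setIntegral_le n.le_succ (hU hA)
  have hn (k : ℕ) (ω : Ω') : ENNReal.ofReal (max (X k ω) 0) = ENNReal.ofReal (X k ω) := by simp
  simp only [truncSeq, le_refl, if_true, hn]
  rw [← ofReal_integral_eq_lintegral_ofReal (hX.integrable _).integrableOn
      (ae_restrict_of_ae (hX_nonneg _)),
    ← ofReal_integral_eq_lintegral_ofReal (hX.integrable _).integrableOn
      (ae_restrict_of_ae (hX_nonneg _))]
  exact ENNReal.ofReal_le_ofReal h1

lemma exists_kernel_initial (hX : Supermartingale X 𝓖 Pr)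
    (hX_nonneg : ∀ n, ∀ᵐ ω ∂Pr, 0 ≤ X n ω) (hX_zero : ∫ ω, X 0 ω ∂Pr ≤ 1) :
    ∃ κ : Kernel Unit ℝ, IsMarkovKernel κ ∧ (∀ h, ∀ᵐ y ∂κ h, 0 ≤ y) ∧
      (∀ h, ∫⁻ y, ENNReal.ofReal y ∂κ h ≤ ENNReal.ofReal 1) ∧
      (Pr.map fun _ ↦ ()) ⊗ₘ κ = Pr.map fun ω ↦ ((), X 0 ω) := by
  refine exists_condDistrib_mean_le (x := fun _ ↦ 1) measurable_const
    ((hX.stronglyAdapted 0).measurable.mono (𝓖.le 0) le_rfl) measurable_const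
    (fun _ ↦ zero_le_one) (hX_nonneg 0) fun A _ ↦ ?_
  rcases A.eq_empty_or_nonempty with rfl | hA
  · simp
  · rw [Subsingleton.eq_univ_of_nonempty hA]
    simp only [Set.preimage_univ, Measure.restrict_univ]
    rw [← ofReal_integral_eq_lintegral_ofReal (hX.integrable 0) (hX_nonneg 0)]
    simpa using hX_zero

/-- The pair `p` consists of a stopping time `τ` and a history `H` in the past of `τ`, padded with
zeros. The `n`-th entry of `H` is the value of `gbm` at `τ`, and `H` has the law of the segment
`X 0, …, X n`. The next uniform variable not used by `p` is `coordR (n + 1)`. -/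
def IsEmbedding (X : ℕ → Ω' → ℝ) (Pr : Measure Ω') (n : ℕ)
    (p : (SampleSpace → WithTop ℝ≥0) × (SampleSpace → ℕ → ℝ)) : Prop :=
  ∃ hτ : IsStoppingTime (stageFiltration (n + 1)) p.1, Measurable[hτ.measurableSpace] p.2 ∧
    (∀ ω, p.2 ω n = gbm (p.1 ω) ω) ∧
    sampleMeasure.map p.2 = Pr.map fun ω ↦ truncSeq n fun k ↦ X k ω

lemma measurable_update_pair (n : ℕ) :
    Measurable fun q : (ℕ → ℝ) × ℝ ↦ Function.update q.1 n q.2 := by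
  refine measurable_pi_lambda _ fun k ↦ ?_
  rcases eq_or_ne k n with rfl | hk
  · simpa using measurable_snd
  · simp only [Function.update_of_ne hk]
    fun_prop

lemma exists_isEmbedding_zero (hX : Supermartingale X 𝓖 Pr)
    (hX_nonneg : ∀ n, ∀ᵐ ω ∂Pr, 0 ≤ X n ω) (hX_zero : ∫ ω, X 0 ω ∂Pr ≤ 1) :
    ∃ p, IsEmbedding X Pr 0 p ∧ ∀ ω, p.2 ω = Function.update (0 : ℕ → ℝ) 0 (gbm (p.1 ω) ω) := by
  obtain ⟨κ, hκM, hκ, hmean, hlaw⟩ := exists_kernel_initial hX hX_nonneg hX_zero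
  obtain ⟨σ, hσ, -, -, hgm, hlawσ⟩ := exists_stoppingTime_of_kernel (n := 0)
    (isStoppingTime_const _ (0 : ℝ≥0)) (H := fun _ ↦ ()) measurable_const κ
    (x := fun _ ↦ 1) measurable_const (fun _ ↦ zero_le_one) hκ hmean
    (ae_expBM_zero.mono fun ω h ↦ (gbm_coe 0 ω).trans h)
  have hX0 : Measurable (X 0) := (hX.stronglyAdapted 0).measurable.mono (𝓖.le 0) le_rfl
  refine ⟨(σ, fun ω ↦ Function.update (0 : ℕ → ℝ) 0 (gbm (σ ω) ω)),
    ⟨hσ, ?_, fun ω ↦ by simp, ?_⟩, fun ω ↦ rfl⟩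
  · exact (measurable_update_pair 0).comp (measurable_const.prodMk hgm)
  · have hgm0 : Measurable fun ω ↦ gbm (σ ω) ω := hgm.mono hσ.measurableSpace_le le_rfl
    have hupd : Measurable fun q : Unit × ℝ ↦ Function.update (0 : ℕ → ℝ) 0 q.2 :=
      (measurable_update_pair 0).comp (measurable_const.prodMk measurable_snd)
    have e : (sampleMeasure.map fun ω ↦ ((), gbm (σ ω) ω)) = Pr.map fun ω ↦ ((), X 0 ω) := by
      rw [hlawσ, ← hlaw, Measure.map_const, Measure.map_const]
      simp
    have e2 := congrArg (Measure.map fun q : Unit × ℝ ↦ Function.update (0 : ℕ → ℝ) 0 q.2) e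
    rw [Measure.map_map hupd (by fun_prop), Measure.map_map hupd (by fun_prop)] at e2
    refine e2.trans (congrArg (fun f ↦ Pr.map f) ?_)
    ext ω k
    rcases eq_or_ne k 0 with rfl | hk
    · simp [truncSeq]
    · simp [truncSeq, hk]

lemma exists_isEmbedding_succ (hX : Supermartingale X 𝓖 Pr)
    (hX_nonneg : ∀ n, ∀ᵐ ω ∂Pr, 0 ≤ X n ω) (n : ℕ)
    (p : (SampleSpace → WithTop ℝ≥0) × (SampleSpace → ℕ → ℝ)) (hp : IsEmbedding X Pr n p) :
    ∃ q, IsEmbedding X Pr (n + 1) q ∧ p.1 ≤ q.1 ∧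
      ∀ ω, q.2 ω = Function.update (p.2 ω) (n + 1) (gbm (q.1 ω) ω) := by
  obtain ⟨τ, H⟩ := p
  obtain ⟨hτ, hH, hval, hlawH⟩ := hp
  dsimp only at hτ hH hval hlawH
  obtain ⟨κ, hκM, hκ, hmean, hlaw⟩ := exists_kernel_supermartingale hX hX_nonneg n
  obtain ⟨σ, hσ, hτσ, hHσ, hgm, hlawσ⟩ := exists_stoppingTime_of_kernel hτ hH κ
    (x := fun h ↦ max (h n) 0) (by fun_prop) (fun h ↦ le_max_right _ _) hκ hmean
    (Eventually.of_forall fun ω ↦ by rw [hval ω, max_eq_left (gbm_nonneg _ _)])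
  refine ⟨(σ, fun ω ↦ Function.update (H ω) (n + 1) (gbm (σ ω) ω)),
    ⟨hσ, (measurable_update_pair (n + 1)).comp (hHσ.prodMk hgm), fun ω ↦ by simp, ?_⟩,
    hτσ, fun ω ↦ rfl⟩
  have hpair : Measurable fun ω ↦ (H ω, gbm (σ ω) ω) :=
    (hHσ.prodMk hgm).mono hσ.measurableSpace_le le_rfl
  have hXm (k : ℕ) : Measurable (X k) := (hX.stronglyAdapted k).measurable.mono (𝓖.le k) le_rfl
  have hpair' : Measurable fun ω ↦ (truncSeq n fun k ↦ X k ω, X (n + 1) ω) :=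
    ((measurable_truncSeq n).comp (measurable_pi_lambda _ hXm)).prodMk (hXm _)
  rw [hlawH, hlaw] at hlawσ
  have e2 := congrArg (Measure.map fun q : (ℕ → ℝ) × ℝ ↦ Function.update q.1 (n + 1) q.2) hlawσ
  rw [Measure.map_map (measurable_update_pair _) hpair,
    Measure.map_map (measurable_update_pair _) hpair'] at e2
  refine e2.trans (congrArg (fun f ↦ Pr.map f) ?_)
  ext1 ω
  exact update_truncSeq n fun k ↦ X k ω

/-- The stopping times are chosen one after the other. Equality in law of all the finite histories
gives equality in law of the processes. -/
theorem exists_stoppingTimes_identDistrib (hX : Supermartingale X 𝓖 Pr)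
    (hX_nonneg : ∀ n, ∀ᵐ ω ∂Pr, 0 ≤ X n ω) (hX_zero : ∫ ω, X 0 ω ∂Pr ≤ 1) :
    ∃ τ : ℕ → SampleSpace → WithTop ℝ≥0, (∀ n, IsStoppingTime sampleFiltration (τ n)) ∧
      Monotone τ ∧
      IdentDistrib (fun ω n ↦ X n ω) (fun ω n ↦ gbm (τ n ω) ω) Pr sampleMeasure := by
  obtain ⟨p₀, hp₀, hp₀'⟩ := exists_isEmbedding_zero hX hX_nonneg hX_zero
  choose! f hf using exists_isEmbedding_succ hX hX_nonneg
  set s : ℕ → (SampleSpace → WithTop ℝ≥0) × (SampleSpace → ℕ → ℝ) :=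
    fun n ↦ Nat.rec p₀ f n with hs_def
  have hs (n : ℕ) : IsEmbedding X Pr n (s n) := by
    induction n with
    | zero => exact hp₀
    | succ n ih => exact (hf n (s n) ih).1
  have hstep (n : ℕ) : (s n).1 ≤ (s (n + 1)).1 := (hf n (s n) (hs n)).2.1
  have hhist (n : ℕ) (ω : SampleSpace) :
      (s n).2 ω = truncSeq n fun k ↦ gbm ((s k).1 ω) ω := by
    induction n with
    | zero =>
      refine (hp₀' ω).trans (funext fun k ↦ ?_)
      rcases eq_or_ne k 0 with rfl | hk
      · simp [truncSeq, hs_def]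
      · simp [truncSeq, hk]
    | succ n ih =>
      have h1 : (s (n + 1)).2 ω = _ := (hf n (s n) (hs n)).2.2 ω
      rw [h1, ih]
      exact update_truncSeq n fun k ↦ gbm ((s k).1 ω) ω
  have hst (n : ℕ) : IsStoppingTime sampleFiltration (s n).1 :=
    isStoppingTime_mono (stageFiltration_le (n + 1)) (hs n).1
  have hXm : Measurable fun ω n ↦ X n ω :=
    measurable_pi_lambda _ fun k ↦ (hX.stronglyAdapted k).measurable.mono (𝓖.le k) le_rfl
  have hgm : Measurable fun ω n ↦ gbm ((s n).1 ω) ω :=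
    measurable_pi_lambda _ fun n ↦
      (measurable_gbm_stopped martingale_expBM (hst n)).mono (hst n).measurableSpace_le le_rfl
  refine ⟨fun n ↦ (s n).1, hst, monotone_nat_of_le_succ hstep,
    ⟨hXm.aemeasurable, hgm.aemeasurable, ?_⟩⟩
  have := Measure.isProbabilityMeasure_map (μ := Pr) hXm.aemeasurable
  have := Measure.isProbabilityMeasure_map (μ := sampleMeasure) hgm.aemeasurable
  refine measure_eq_of_map_truncSeq_eq fun n ↦ ?_
  obtain ⟨-, -, -, hlaw⟩ := hs n
  rw [Measure.map_map (measurable_truncSeq n) hXm, Measure.map_map (measurable_truncSeq n) hgm]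
  refine hlaw.symm.trans (congrArg (fun f ↦ sampleMeasure.map f) (funext fun ω ↦ hhist n ω))

end Embedding

end

end GBMEmbedding

open GBMEmbedding in
theorem lemma2p3 {Ω' : Type*} {m' : MeasurableSpace Ω'} (Pr : Measure Ω')
    [IsProbabilityMeasure Pr] (𝓖 : Filtration ℕ m') (X : ℕ → Ω' → ℝ)
    (hX : Supermartingale X 𝓖 Pr) (hX_nonneg : ∀ n, ∀ᵐ ω ∂Pr, 0 ≤ X n ω)
    (hX_zero : ∫ ω, X 0 ω ∂Pr ≤ 1) :
    -- the `R n` are independent, `F_0`-measurable and uniformly distributed on `[0,1]`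
    (iIndepFun coordR sampleMeasure ∧
      (∀ n, Measurable[sampleFiltration 0] (coordR n)) ∧
      (∀ n, HasLaw (coordR n) (volume : Measure unitInterval) sampleMeasure)) ∧
    -- `B` is an `(F_t, P)`-Brownian motion, independent of the sequence `R`
    (IsBrownianMotionFor coordB sampleFiltration sampleMeasure ∧
      IndepFun (fun ω (t : ℝ≥0) => coordB t ω) (fun ω n => coordR n ω) sampleMeasure) ∧
    -- the embedding
    ∃ τ : ℕ → SampleSpace → WithTop ℝ≥0,
      (∀ n, IsStoppingTime sampleFiltration (τ n)) ∧
      Monotone τ ∧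
      IdentDistrib (fun ω n => X n ω) (fun ω n => gbm (τ n ω) ω) Pr sampleMeasure := by
  refine ⟨⟨iIndepFun_coordR, fun n ↦ measurable_coordR_zero n 0, hasLaw_coordR⟩,
    ⟨isBrownianMotionFor_coordB, indepFun_coordB_coordR⟩, ?_⟩
  exact exists_stoppingTimes_identDistrib hX hX_nonneg hX_zero
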